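/- Work over $\mathbb C$, with vector fields $P(x,y)\partial_x+Q(x,y)\partial_y$ whose coefficients are $C^\infty$ in the complex sense (that is, holomorphic) on an open subset of $\mathbb C^2$. For such a Lie algebra $\mathfrak g$, write $\mathfrak g'=[\mathfrak g,\mathfrak g]$; the rank of $\mathfrak g$ is the dimension of its generic orbit, i.e. the value which $\dim\{X(p)\mid X\in\mathfrak g\}$ takes on a dense open set of points $p$. For a finite set $S\subset\mathbb C$ and positive integers $n_\lambda$ ($\lambda\in S$), let $$\mathfrak h=\sum_{\lambda\in S}V(\lambda),\qquad V(\lambda)=\{\,e^{\lambda y}P(y)\partial_x \mid P\in\mathbb C[y],\ \deg P<n_\lambda\,\}.$$ Vector fields act on $\mathfrak h$ by the Lie bracket, "multiplicity" means algebraic multiplicity (the dimension of the generalized eigenspace, equal to $0$ if the number in question is not an eigenvalue), and $\langle\ \rangle$ denotes the linear span. Let $\mathfrak g$ be a finite-dimensional Lie algebra of vector fields on a connected open set $U\subseteq\mathbb C^2$ which is solvable and not nilpotent and has rank $2$, and suppose that $\mathfrak g'$ is abelian and of rank $1$. Then every nonempty open subset of $U$ contains a nonempty open set carrying local coordinates $(x,y)$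 (given by a biholomorphic map onto an open subset of $\mathbb C^2$) in which, for some $S$ and $(n_\lambda)_{\lambda\in S}$ as above, $\mathfrak g'=\mathfrak h$ and $\mathfrak g$ is one of the following: 1. $\mathfrak g=\langle\mathfrak h,\partial_y\rangle$, where zero is not an eigenvalue of $\partial_y$ operating on $\mathfrak h$; 2. $\mathfrak g=\langle\mathfrak h,\partial_y,x\partial_x\rangle$; 3. $\mathfrak g=\langle\mathfrak h,\partial_y,y^N\partial_x\rangle$, where $N\ge 0$ is the multiplicity of the eigenvalue zero of $\partial_y$ operating on $\mathfrak h$; 4. $\mathfrak g=\langle\mathfrak h,x\partial_x+\partial_y\rangle$, where zero is not an eigenvalue of $x\partial_x+\partial_y$ operating on $\mathfrak h$; 5. $\mathfrak g=\langle\mathfrak h,x\partial_x+\partial_y,y^Ne^y\partial_x\rangle$, where $N\ge 0$ is the multiplicity of the eigenvalue zero of $x\partial_x+\partial_y$ operating on $\mathfrak h$; 6. $\mathfrak g=\langle\mathfrak h,x\partial_x+\partial_y,x\partial_x+y^Ne^y\partial_x\rangle$, where $N>0$ is the multiplicity of the eigenvalue zero of $x\partial_x+\partial_y$ operating on $\mathfrak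 h$. Moreover, for every $S$ and $(n_\lambda)$ as above, each of the spans 1–6 (under its stated condition), on any open subset of $\mathbb C^2$, is a Lie algebra whose commutator algebra is $\mathfrak h$. -/

import Mathlib

open scoped ContDiff

noncomputable section

namespace PlaneFields

open TopologicalSpace

/-! Points of `ℂ × ℂ` are written `p = (x, y)`, that is `x = p.1` and `y = p.2`.
A vector field `P ∂_x + Q ∂_y` is the map `p ↦ (P p, Q p)`. -/

/-- The complex vector space of vector fields `P ∂_x + Q ∂_y` on the open set `U ⊆ ℂ²`, with `P`, `Q`
of class `C^∞` in the complex sense on `U` (equivalently, holomorphic).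
A field on `U` is represented by its extension by zero to `ℂ²`, so that two
fields are equal if and only if they agree on `U`. -/
def VF (U : Opens (ℂ × ℂ)) : Submodule ℂ (ℂ × ℂ → ℂ × ℂ) where
  carrier := {V | ContDiffOn ℂ ∞ V U ∧ ∀ p ∉ U, V p = 0}
  add_mem' := by
    rintro V W ⟨hV, hV0⟩ ⟨hW, hW0⟩
    exact ⟨hV.add hW, fun p hp => by simp [hV0 p hp, hW0 p hp]⟩
  zero_mem' := ⟨contDiffOn_const, fun _ _ => rfl⟩
  smul_mem' := by
    rintro c V ⟨hV, hV0⟩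
    exact ⟨contDiffOn_const.smul hV, fun p hp => by simp [hV0 p hp]⟩

variable {U : Opens (ℂ × ℂ)}

open Classical in
/-- Restriction to `U` of a map that is smooth on `U`, as a vector field on `U`. -/
def VF.mk (U : Opens (ℂ × ℂ)) (f : ℂ × ℂ → ℂ × ℂ) (hf : ContDiffOn ℂ ∞ f U) : VF U :=
  ⟨fun p => if p ∈ U then f p else 0,
    hf.congr fun _ hp => if_pos hp, fun _ hp => if_neg hp⟩

lemma VF.mk_apply {f : ℂ × ℂ → ℂ × ℂ} (hf : ContDiffOn ℂ ∞ f U) {p : ℂ × ℂ} (hp : p ∈ U) :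
    (VF.mk U f hf).1 p = f p := if_pos hp

lemma VF.ext_on {V W : VF U} (h : ∀ p ∈ U, V.1 p = W.1 p) : V = W := by
  apply Subtype.ext
  funext p
  by_cases hp : p ∈ U
  · exact h p hp
  · rw [V.2.2 p hp, W.2.2 p hp]

lemma VF.contDiffAt (V : VF U) {p : ℂ × ℂ} (hp : p ∈ U) : ContDiffAt ℂ ∞ V.1 p :=
  V.2.1.contDiffAt (U.isOpen.mem_nhds hp)

lemma VF.differentiableAt (V : VF U) {p : ℂ × ℂ} (hp : p ∈ U) : DifferentiableAt ℂ V.1 p :=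
  (VF.contDiffAt V hp).differentiableAt (by simp)

lemma VF.contDiffOn_lieBracket (V W : VF U) :
    ContDiffOn ℂ ∞ (VectorField.lieBracket ℂ V.1 W.1) U := fun _ hp =>
  ((VF.contDiffAt V hp).lieBracket_vectorField (VF.contDiffAt W hp) (by simp)).contDiffWithinAt

/-- The Lie bracket of vector fields, `[V, W](p) = DW(p) V(p) - DV(p) W(p)` for `p ∈ U`. -/
instance : Bracket (VF U) (VF U) where
  bracket V W := VF.mk U (VectorField.lieBracket ℂ V.1 W.1) (VF.contDiffOn_lieBracket V W)

lemma VF.bracket_apply (V W : VF U) {p : ℂ × ℂ} (hp : p ∈ U) :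
    (⁅V, W⁆ : VF U).1 p = VectorField.lieBracket ℂ V.1 W.1 p :=
  VF.mk_apply _ hp

lemma VF.bracket_eventuallyEq (V W : VF U) {p : ℂ × ℂ} (hp : p ∈ U) :
    (⁅V, W⁆ : VF U).1 =ᶠ[nhds p] VectorField.lieBracket ℂ V.1 W.1 := by
  filter_upwards [U.isOpen.mem_nhds hp] with q hq using VF.bracket_apply V W hq

instance : LieRing (VF U) where
  add_lie V W X := VF.ext_on fun p hp => by
    have h : (⁅V, X⁆ + ⁅W, X⁆ : VF U).1 p = (⁅V, X⁆ : VF U).1 p + (⁅W, X⁆ : VF U).1 p := rfl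
    rw [h, VF.bracket_apply _ _ hp, VF.bracket_apply _ _ hp, VF.bracket_apply _ _ hp]
    exact VectorField.lieBracket_add_left (VF.differentiableAt V hp) (VF.differentiableAt W hp)
  lie_add V W X := VF.ext_on fun p hp => by
    have h : (⁅V, W⁆ + ⁅V, X⁆ : VF U).1 p = (⁅V, W⁆ : VF U).1 p + (⁅V, X⁆ : VF U).1 p := rfl
    rw [h, VF.bracket_apply _ _ hp, VF.bracket_apply _ _ hp, VF.bracket_apply _ _ hp]
    exact VectorField.lieBracket_add_right (VF.differentiableAt W hp) (VF.differentiableAt X hp)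
  lie_self V := VF.ext_on fun p hp => by
    rw [VF.bracket_apply _ _ hp, VectorField.lieBracket_self]
    rfl
  leibniz_lie V W X := VF.ext_on fun p hp => by
    have h : (⁅⁅V, W⁆, X⁆ + ⁅W, ⁅V, X⁆⁆ : VF U).1 p
      = (⁅⁅V, W⁆, X⁆ : VF U).1 p + (⁅W, ⁅V, X⁆⁆ : VF U).1 p := rfl
    rw [h, VF.bracket_apply _ _ hp, VF.bracket_apply _ _ hp, VF.bracket_apply _ _ hp,
      Filter.EventuallyEq.lieBracket_vectorField_eq Filter.EventuallyEq.rfl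
        (VF.bracket_eventuallyEq W X hp),
      Filter.EventuallyEq.lieBracket_vectorField_eq (VF.bracket_eventuallyEq V W hp)
        Filter.EventuallyEq.rfl,
      Filter.EventuallyEq.lieBracket_vectorField_eq Filter.EventuallyEq.rfl
        (VF.bracket_eventuallyEq V X hp)]
    exact VectorField.leibniz_identity_lieBracket (n := ∞)
      (by rw [minSmoothness_of_isRCLikeNormedField]; exact WithTop.coe_le_coe.2 le_top)
      (VF.contDiffAt V hp) (VF.contDiffAt W hp) (VF.contDiffAt X hp)

instance : LieAlgebra ℂ (VF U) where
  lie_smul c V W := VF.ext_on fun p hp => by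
    have h : (c • ⁅V, W⁆ : VF U).1 p = c • (⁅V, W⁆ : VF U).1 p := rfl
    rw [h, VF.bracket_apply _ _ hp, VF.bracket_apply _ _ hp]
    exact VectorField.lieBracket_const_smul_right (VF.differentiableAt W hp)

/-- The commutator algebra `g' = [g, g]` of a Lie subalgebra `g` of `L`, as a subalgebra of `L`. -/
def commutatorAlgebra {L : Type*} [LieRing L] [LieAlgebra ℂ L] (g : LieSubalgebra ℂ L) :
    LieSubalgebra ℂ L :=
  (LieAlgebra.derivedSeries ℂ g 1).toLieSubalgebra.map g.incl

/-- The value at `p`, as a linear map on vector fields. -/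
def evalAt (p : ℂ × ℂ) : VF U →ₗ[ℂ] ℂ × ℂ :=
  (LinearMap.proj (R := ℂ) (φ := fun _ : ℂ × ℂ => ℂ × ℂ) p) ∘ₗ (VF U).subtype

/-- The dimension at `p` of the orbit of the Lie algebra `g` of vector fields: the dimension of the
tangent space `{V(p) | V ∈ g}` of the orbit. -/
def orbitDim (g : LieSubalgebra ℂ (VF U)) (p : ℂ × ℂ) : ℕ :=
  Module.finrank ℂ (g.toSubmodule.map (evalAt p))

/-- The rank of `g` is `r`: the generic orbit has dimension `r`, i.e. the orbits through the points
of some dense open subset of `U` have dimension `r`. -/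
def HasRank (g : LieSubalgebra ℂ (VF U)) (r : ℕ) : Prop :=
  ∃ O : Opens (ℂ × ℂ), O ≤ U ∧ (U : Set (ℂ × ℂ)) ⊆ closure (O : Set (ℂ × ℂ)) ∧
    ∀ p ∈ O, orbitDim g p = r

/-- A local change of coordinates with domain inside `U`: a `C^∞` diffeomorphism, in the complex
sense, of a nonempty open subset of `U` onto an open subset of `ℂ²`. -/
structure LocalCoordinates (U : Opens (ℂ × ℂ)) where
  toHomeo : OpenPartialHomeomorph (ℂ × ℂ) (ℂ × ℂ)
  nonempty_source : toHomeo.source.Nonempty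
  source_subset : toHomeo.source ⊆ U
  contDiffOn_toFun : ContDiffOn ℂ ∞ toHomeo toHomeo.source
  contDiffOn_symm : ContDiffOn ℂ ∞ toHomeo.symm toHomeo.target

/-- The open subset of `ℂ²` in which the new coordinates take their values. -/
def LocalCoordinates.range (φ : LocalCoordinates U) : Opens (ℂ × ℂ) :=
  ⟨φ.toHomeo.target, φ.toHomeo.open_target⟩

lemma LocalCoordinates.contDiffOn_push (φ : LocalCoordinates U) (V : VF U) :
    ContDiffOn ℂ ∞
      (fun q => fderiv ℂ φ.toHomeo (φ.toHomeo.symm q) (V.1 (φ.toHomeo.symm q))) φ.range := by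
  have hmaps : Set.MapsTo φ.toHomeo.symm φ.toHomeo.target φ.toHomeo.source :=
    φ.toHomeo.symm.mapsTo
  have h1 : ContDiffOn ℂ ∞ (fderiv ℂ φ.toHomeo) φ.toHomeo.source :=
    φ.contDiffOn_toFun.fderiv_of_isOpen φ.toHomeo.open_source (by simp)
  exact (h1.comp φ.contDiffOn_symm hmaps).clm_apply
    ((V.2.1.mono φ.source_subset).comp φ.contDiffOn_symm hmaps)

/-- The expression of a vector field in the new coordinates: the vector field
`q ↦ Dφ(φ⁻¹ q) V(φ⁻¹ q)` on the range of `φ`. -/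
def LocalCoordinates.push (φ : LocalCoordinates U) : VF U →ₗ[ℂ] VF φ.range where
  toFun V := VF.mk φ.range
    (fun q => fderiv ℂ φ.toHomeo (φ.toHomeo.symm q) (V.1 (φ.toHomeo.symm q)))
    (φ.contDiffOn_push V)
  map_add' V W := VF.ext_on fun q hq => by
    refine (VF.mk_apply _ hq).trans ((map_add _ _ _).trans ?_)
    exact congrArg₂ _ (VF.mk_apply (φ.contDiffOn_push V) hq).symm
      (VF.mk_apply (φ.contDiffOn_push W) hq).symm
  map_smul' c V := VF.ext_on fun q hq => by
    refine (VF.mk_apply _ hq).trans ((map_smul (fderiv ℂ φ.toHomeo (φ.toHomeo.symm q)) c _).trans ?_)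
    exact congrArg _ (VF.mk_apply (φ.contDiffOn_push V) hq).symm

variable (U)

/-- The vector field `∂_y`. -/
def dy : VF U := VF.mk U (fun _ => (0, 1)) contDiffOn_const

/-- The vector field `x ∂_x`. -/
def xdx : VF U := VF.mk U (fun p => (p.1, 0)) (by fun_prop)

lemma contDiff_expPoly (μ : ℂ) (P : Polynomial ℂ) :
    ContDiff ℂ ∞ (fun p : ℂ × ℂ => ((Complex.exp (μ * p.2) * P.eval p.2, 0) : ℂ × ℂ)) := by
  have hP : ContDiff ℂ ∞ (fun y : ℂ => P.eval y) := by
    simpa using P.contDiff_aeval (𝕜 := ℂ) ∞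
  have h2 : ContDiff ℂ ∞ (fun p : ℂ × ℂ => P.eval p.2) := hP.comp contDiff_snd
  have h1 : ContDiff ℂ ∞ (fun p : ℂ × ℂ => Complex.exp (μ * p.2)) :=
    (contDiff_const.mul contDiff_snd).cexp
  exact (h1.mul h2).prodMk contDiff_const

/-- The vector field `e^{μ y} P(y) ∂_x`, depending linearly on the polynomial `P`. -/
def expPoly (μ : ℂ) : Polynomial ℂ →ₗ[ℂ] VF U where
  toFun P := VF.mk U (fun p => (Complex.exp (μ * p.2) * P.eval p.2, 0))
    (contDiff_expPoly μ P).contDiffOn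
  map_add' P Q := VF.ext_on fun p hp => by
    rw [Submodule.coe_add, Pi.add_apply, VF.mk_apply _ hp, VF.mk_apply _ hp, VF.mk_apply _ hp]
    simp [mul_add]
  map_smul' c P := VF.ext_on fun p hp => by
    rw [RingHom.id_apply, Submodule.coe_smul, Pi.smul_apply, VF.mk_apply _ hp, VF.mk_apply _ hp]
    simp [mul_left_comm]

/-- The space `V(μ)` of all vector fields `e^{μ y} P(y) ∂_x` with `deg P < m`. -/
def quasiPoly (μ : ℂ) (m : ℕ) : Submodule ℂ (VF U) :=
  (Polynomial.degreeLT ℂ m).map (expPoly U μ)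

/-- The space `h = ∑_{μ ∈ S} V(μ)`, where `V(μ)` consists of the fields `e^{μ y} P(y) ∂_x` with
`deg P < n μ`. -/
def hSpace (S : Finset ℂ) (n : ℂ → ℕ) : Submodule ℂ (VF U) :=
  ⨆ μ ∈ S, quasiPoly U μ (n μ)

variable {U}

/-- Zero is an eigenvalue of (the adjoint action of) `X` operating on `h`. -/
def ZeroEigenvalueOn (X : VF U) (h : Submodule ℂ (VF U)) : Prop :=
  ∃ V ∈ h, V ≠ 0 ∧ ⁅X, V⁆ = 0

/-- The (algebraic) multiplicity of the eigenvalue zero of `X` operating on `h`: the dimension of the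
generalized eigenspace; it is `0` if zero is not an eigenvalue. -/
def zeroMultiplicityOn (X : VF U) (h : Submodule ℂ (VF U)) : ℕ :=
  Module.finrank ℂ
    ↥(h ⊓ Module.End.maxGenEigenspace ((LieAlgebra.ad ℂ (VF U) X : Module.End ℂ (VF U))) 0)

open Polynomial in
/-- `F` is one of the six normal forms built on the space `h` given by `S` and `n`; here angle
brackets of the mathematical notation are linear spans. -/
def IsNormalForm (S : Finset ℂ) (n : ℂ → ℕ) (F : Submodule ℂ (VF U)) : Prop :=
  let h := hSpace U S n
  let N₀ := zeroMultiplicityOn (dy U) h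
  let N₁ := zeroMultiplicityOn (xdx U + dy U) h
  (¬ ZeroEigenvalueOn (dy U) h ∧ F = h ⊔ Submodule.span ℂ {dy U}) ∨
  (F = h ⊔ Submodule.span ℂ {dy U, xdx U}) ∨
  (F = h ⊔ Submodule.span ℂ {dy U, expPoly U 0 (X ^ N₀)}) ∨
  (¬ ZeroEigenvalueOn (xdx U + dy U) h ∧ F = h ⊔ Submodule.span ℂ {xdx U + dy U}) ∨
  (F = h ⊔ Submodule.span ℂ {xdx U + dy U, expPoly U 1 (X ^ N₁)}) ∨
  (0 < N₁ ∧ F = h ⊔ Submodule.span ℂ {xdx U + dy U, xdx U + expPoly U 1 (X ^ N₁)})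

end PlaneFields

end

noncomputable section
namespace PlaneFields
open TopologicalSpace Polynomial
variable {U : Opens (ℂ × ℂ)}

/-! Near a generic point choose independent V in g' and X in g. Since g' has rank 1, [X, V] = fV
there; since g' is abelian, [V, fV] = 0, that is Vf = 0. These two relations make the dual coframe
of (V, X) integrable after an integrating factor e^{-m}, which gives coordinates with X = ∂_y and V
= v(y)∂_x, v nowhere zero (`exists_adapted_coordinates`).

The rest is linear algebra of the operator ∂_y. Fields of g' commute with V, so they have the form
w(y)∂_x; they make up a finite-dimensional space stable under ∂_y, which splits into generalized
eigenspaces consisting of exponential polynomials (`exists_eq_hSpace`). For Y in g, both [V, Y] and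
[∂_y, Y] lie in g', which forces Y = q∂_y + a x∂_x + u(y)∂_x (`exists_sub_mem_yFields`), and
integrating [∂_y, u∂_x] ∈ h puts u∂_x in h + ⟨e⟩, where e = y^N∂_x. As [x∂_x + ce, e] = -e is not in
h, the algebra g is h + ⟨∂_y⟩, with at most one further generator, e or x∂_x + ce
(`eq_of_commutatorAlgebra_eq`). With no further generator, h = [∂_y, h], so zero is not an
eigenvalue. A nonzero c is removed by a translation in x if N = 0, and normalized by x ↦ c⁻¹e^y x if
N > 0, which gives form 6 (`exists_isNormalForm_of_eq`). Forms 4 and 5 are the images of 1 and 3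
under x ↦ e^y x, so the existence part never needs them.

For the converse, c x∂_x + ∂_y with c = 0, 1 acts on the polynomial factor of e^{μy}P(y)∂_x as (μ -
c) + d/dy: invertible for μ ≠ c, nilpotent for μ = c, where y^N e^{cy}∂_x supplies the one missing
antiderivative. -/

lemma VF.coe_add_apply (V W : VF U) (p : ℂ × ℂ) : (V + W).1 p = V.1 p + W.1 p := rfl

lemma VF.coe_sub_apply (V W : VF U) (p : ℂ × ℂ) : (V - W).1 p = V.1 p - W.1 p := rfl

lemma VF.coe_smul_apply (c : ℂ) (V : VF U) (p : ℂ × ℂ) : (c • V).1 p = c • V.1 p := rfl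

lemma VF.bracket_eq (V W : VF U) {p : ℂ × ℂ} (hp : p ∈ U) :
    (⁅V, W⁆ : VF U).1 p = fderiv ℂ W.1 p (V.1 p) - fderiv ℂ V.1 p (W.1 p) :=
  VF.bracket_apply V W hp

lemma VF.fderiv_eq {V : VF U} {f : ℂ × ℂ → ℂ × ℂ} (h : ∀ p ∈ U, V.1 p = f p) {p : ℂ × ℂ}
    (hp : p ∈ U) : fderiv ℂ V.1 p = fderiv ℂ f p :=
  Filter.EventuallyEq.fderiv_eq (Filter.eventuallyEq_of_mem (U.isOpen.mem_nhds hp) h)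

/-! ### The model fields and their brackets -/

lemma dy_apply {p : ℂ × ℂ} (hp : p ∈ U) : (dy U).1 p = (0, 1) := VF.mk_apply _ hp

lemma xdx_apply {p : ℂ × ℂ} (hp : p ∈ U) : (xdx U).1 p = (p.1, 0) := VF.mk_apply _ hp

lemma expPoly_apply (μ : ℂ) (P : ℂ[X]) {p : ℂ × ℂ} (hp : p ∈ U) :
    (expPoly U μ P).1 p = (Complex.exp (μ * p.2) * P.eval p.2, 0) :=
  VF.mk_apply (contDiff_expPoly μ P).contDiffOn hp

lemma fderiv_dy {p : ℂ × ℂ} (hp : p ∈ U) : fderiv ℂ (dy U).1 p = 0 := by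
  rw [VF.fderiv_eq (fun q hq => dy_apply hq) hp]; simp

lemma fderiv_xdx {p : ℂ × ℂ} (hp : p ∈ U) (v : ℂ × ℂ) :
    fderiv ℂ (xdx U).1 p v = (v.1, 0) := by
  rw [VF.fderiv_eq (fun q hq => xdx_apply hq) hp]
  have : HasFDerivAt (fun q : ℂ × ℂ => ((q.1, 0) : ℂ × ℂ))
      ((ContinuousLinearMap.fst ℂ ℂ ℂ).prod 0) p :=
    hasFDerivAt_fst.prodMk (hasFDerivAt_const (0 : ℂ) p)
  rw [this.fderiv]; simp

lemma hasDerivAt_expPoly (μ : ℂ) (P : ℂ[X]) (y : ℂ) :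
    HasDerivAt (fun y => Complex.exp (μ * y) * P.eval y)
      (Complex.exp (μ * y) * (C μ * P + derivative P).eval y) y := by
  have h1 : HasDerivAt (fun y => Complex.exp (μ * y)) (Complex.exp (μ * y) * (μ * 1)) y :=
    ((hasDerivAt_id y).const_mul μ).cexp
  convert! h1.mul (P.hasDerivAt y) using 1
  simp; ring

lemma fderiv_expPoly (μ : ℂ) (P : ℂ[X]) {p : ℂ × ℂ} (hp : p ∈ U) (v : ℂ × ℂ) :
    fderiv ℂ (expPoly U μ P).1 p v =
      v.2 • (expPoly U μ (C μ * P + derivative P)).1 p := by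
  rw [VF.fderiv_eq (fun q hq => expPoly_apply μ P hq) hp, expPoly_apply _ _ hp]
  have h := ((hasDerivAt_expPoly μ P p.2).hasFDerivAt.comp p hasFDerivAt_snd).prodMk
    (hasFDerivAt_const (0 : ℂ) p)
  simp only [Function.comp_def] at h
  rw [h.fderiv]; simp

lemma dy_lie_apply (V : VF U) {p : ℂ × ℂ} (hp : p ∈ U) :
    (⁅dy U, V⁆ : VF U).1 p = fderiv ℂ V.1 p (0, 1) := by
  rw [VF.bracket_eq _ _ hp, fderiv_dy hp, dy_apply hp]; simp

lemma dy_lie_expPoly (μ : ℂ) (P : ℂ[X]) :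
    ⁅dy U, expPoly U μ P⁆ = expPoly U μ (C μ * P + derivative P) := by
  refine VF.ext_on fun p hp => ?_
  rw [dy_lie_apply _ hp, fderiv_expPoly _ _ hp]; simp

lemma xdx_lie_expPoly (μ : ℂ) (P : ℂ[X]) :
    ⁅xdx U, expPoly U μ P⁆ = -expPoly U μ P := by
  refine VF.ext_on fun p hp => ?_
  have h : (-expPoly U μ P).1 p = -(expPoly U μ P).1 p := rfl
  rw [VF.bracket_eq _ _ hp, fderiv_expPoly _ _ hp, fderiv_xdx hp, xdx_apply hp, h,
    expPoly_apply μ P hp]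
  simp

lemma expPoly_lie_expPoly (μ ν : ℂ) (P Q : ℂ[X]) : ⁅expPoly U μ P, expPoly U ν Q⁆ = 0 := by
  refine VF.ext_on fun p hp => ?_
  rw [VF.bracket_eq _ _ hp, fderiv_expPoly _ _ hp, fderiv_expPoly _ _ hp, expPoly_apply μ P hp,
    expPoly_apply ν Q hp]
  simp

lemma dy_lie_xdx : ⁅dy U, xdx U⁆ = 0 := by
  refine VF.ext_on fun p hp => ?_
  rw [dy_lie_apply _ hp, fderiv_xdx hp]; simp

variable (U) in
/-- The vector field `c x ∂_x + ∂_y`. -/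
def shear (c : ℂ) : VF U := c • xdx U + dy U

lemma shear_zero : shear U 0 = dy U := by simp [shear]

lemma shear_one : shear U 1 = xdx U + dy U := by simp [shear]

/-- The operator by which `c x ∂_x + ∂_y` acts on the polynomial factor of `e^{μ y} P(y) ∂_x`, where
`a = μ - c`. -/
def shiftDeriv (a : ℂ) : ℂ[X] →ₗ[ℂ] ℂ[X] := a • LinearMap.id + derivative

lemma shiftDeriv_apply (a : ℂ) (P : ℂ[X]) : shiftDeriv a P = C a * P + derivative P := by
  simp [shiftDeriv, smul_eq_C_mul]

/-- The summand c x∂_x acts on fields w(y)∂_x as the scalar -c, so it only shifts the exponent. This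
lets the forms built on ∂_y and on x∂_x + ∂_y be treated together. -/
lemma shear_lie_expPoly (c μ : ℂ) (P : ℂ[X]) :
    ⁅shear U c, expPoly U μ P⁆ = expPoly U μ (shiftDeriv (μ - c) P) := by
  rw [shear, add_lie, smul_lie, xdx_lie_expPoly, dy_lie_expPoly, shiftDeriv_apply, smul_neg,
    ← map_smul, ← map_neg, ← map_add, smul_eq_C_mul]
  congr 1
  rw [C_sub]; ring

/-! ### The operator a + d/dy on polynomials of bounded degree -/

lemma derivative_mem_degreeLT {m : ℕ} {P : ℂ[X]} (hP : P ∈ degreeLT ℂ (m + 1)) :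
    derivative P ∈ degreeLT ℂ m := by
  rw [mem_degreeLT, degree_lt_iff_coeff_zero] at *
  intro k hk
  rw [coeff_derivative, hP (k + 1) (by omega), zero_mul]

lemma degreeLT_le_succ (m : ℕ) : degreeLT ℂ m ≤ degreeLT ℂ (m + 1) :=
  degreeLT_mono (Nat.le_succ m)

lemma shiftDeriv_mem_degreeLT (a : ℂ) {m : ℕ} {P : ℂ[X]} (hP : P ∈ degreeLT ℂ m) :
    shiftDeriv a P ∈ degreeLT ℂ m := by
  rw [shiftDeriv_apply, ← smul_eq_C_mul]
  exact add_mem (Submodule.smul_mem _ _ hP) (derivative_mem_degreeLT (degreeLT_le_succ m hP))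

/-- The derivative is nilpotent in bounded degree, so a + d/dy is invertible there when a ≠ 0. -/
lemma exists_shiftDeriv_eq {a : ℂ} (ha : a ≠ 0) (m : ℕ) (P : ℂ[X]) (hP : P ∈ degreeLT ℂ m) :
    ∃ Q ∈ degreeLT ℂ m, shiftDeriv a Q = P := by
  induction m generalizing P with
  | zero => exact ⟨0, zero_mem _, by
      have : P = 0 := by simpa [mem_degreeLT] using hP
      simp [this]⟩
  | succ m ih =>
    obtain ⟨R, hR, hRP⟩ := ih _ (derivative_mem_degreeLT hP)
    -- If (a + D)R = DP, then (a + D)(P - R) = aP, because aR = D(P - R).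
    refine ⟨a⁻¹ • (P - R), Submodule.smul_mem _ _ (sub_mem hP (degreeLT_le_succ m hR)), ?_⟩
    rw [shiftDeriv_apply] at hRP ⊢
    have : C a⁻¹ * C a = 1 := by rw [← C_mul, inv_mul_cancel₀ ha, C_1]
    rw [smul_eq_C_mul, derivative_mul, derivative_sub, ← hRP]
    simp only [derivative_C]
    linear_combination P * this

lemma exists_derivative_eq (m : ℕ) (P : ℂ[X]) (hP : P ∈ degreeLT ℂ m) :
    ∃ Q ∈ degreeLT ℂ (m + 1), derivative Q = P := by
  rw [degreeLT_eq_span_X_pow] at hP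
  induction hP using Submodule.span_induction with
  | mem x hx =>
    simp only [Finset.coe_image, Finset.coe_range, Set.mem_image, Set.mem_Iio] at hx
    obtain ⟨k, hk, rfl⟩ := hx
    refine ⟨C ((k + 1 : ℂ)⁻¹) * X ^ (k + 1), ?_, ?_⟩
    · rw [mem_degreeLT]
      exact (degree_C_mul_X_pow_le _ _).trans_lt (by exact_mod_cast Nat.succ_lt_succ hk)
    · have h : (k + 1 : ℂ) ≠ 0 := Nat.cast_add_one_ne_zero k
      rw [derivative_C_mul_X_pow]
      push_cast
      rw [inv_mul_cancel₀ h]; simp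
  | zero => exact ⟨0, zero_mem _, by simp⟩
  | add x y _ _ hx hy =>
    obtain ⟨Q, hQ, rfl⟩ := hx
    obtain ⟨R, hR, rfl⟩ := hy
    exact ⟨Q + R, add_mem hQ hR, by simp⟩
  | smul a x _ hx =>
    obtain ⟨Q, hQ, rfl⟩ := hx
    exact ⟨a • Q, Submodule.smul_mem _ _ hQ, by simp⟩

lemma degreeLT_succ_eq (m : ℕ) : degreeLT ℂ (m + 1) = degreeLT ℂ m ⊔ ℂ ∙ (X ^ m : ℂ[X]) := by
  classical
  rw [degreeLT_eq_span_X_pow, degreeLT_eq_span_X_pow, Finset.range_add_one, Finset.image_insert,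
    Finset.coe_insert, Submodule.span_insert, sup_comm]

/-! ### The spaces V(μ) and h -/

lemma expPoly_mem_quasiPoly (μ : ℂ) {m : ℕ} {P : ℂ[X]} (hP : P ∈ degreeLT ℂ m) :
    expPoly U μ P ∈ quasiPoly U μ m := Submodule.mem_map_of_mem hP

lemma quasiPoly_zero (μ : ℂ) : quasiPoly U μ 0 = ⊥ := by
  have : degreeLT ℂ 0 = ⊥ := by
    ext P; simp [mem_degreeLT]
  rw [quasiPoly, this, Submodule.map_bot]

lemma quasiPoly_succ (μ : ℂ) (m : ℕ) :
    quasiPoly U μ (m + 1) = quasiPoly U μ m ⊔ ℂ ∙ (expPoly U μ (X ^ m)) := by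
  rw [quasiPoly, degreeLT_succ_eq, Submodule.map_sup, Submodule.map_span, Set.image_singleton]
  rfl

/-- The number `n c` if `c ∈ S`, and zero otherwise. -/
def mult (S : Finset ℂ) (n : ℂ → ℕ) (c : ℂ) : ℕ := by
  classical exact if c ∈ S then n c else 0

lemma mult_of_mem {S : Finset ℂ} {n : ℂ → ℕ} {c : ℂ} (h : c ∈ S) : mult S n c = n c := if_pos h

lemma mult_of_notMem {S : Finset ℂ} {n : ℂ → ℕ} {c : ℂ} (h : c ∉ S) : mult S n c = 0 := if_neg h

lemma quasiPoly_mult_le (S : Finset ℂ) (n : ℂ → ℕ) (c : ℂ) :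
    quasiPoly U c (mult S n c) ≤ hSpace U S n := by
  by_cases h : c ∈ S
  · rw [mult_of_mem h]
    exact le_iSup₂_of_le (f := fun μ (_ : μ ∈ S) => quasiPoly U μ (n μ)) c h le_rfl
  · rw [mult_of_notMem h, quasiPoly_zero]
    exact bot_le

lemma quasiPoly_le_hSpace {S : Finset ℂ} {n : ℂ → ℕ} {μ : ℂ} (h : μ ∈ S) :
    quasiPoly U μ (n μ) ≤ hSpace U S n := mult_of_mem (n := n) h ▸ quasiPoly_mult_le S n μ

@[elab_as_elim]
lemma hSpace_induction {S : Finset ℂ} {n : ℂ → ℕ} {p : (V : VF U) → V ∈ hSpace U S n → Prop}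
    (mem : ∀ μ (hμ : μ ∈ S) P (hP : P ∈ degreeLT ℂ (n μ)),
      p (expPoly U μ P) (quasiPoly_le_hSpace hμ (expPoly_mem_quasiPoly μ hP)))
    (zero : p 0 (zero_mem _))
    (add : ∀ V W hV hW, p V hV → p W hW → p (V + W) (add_mem hV hW)) {V : VF U}
    (hV : V ∈ hSpace U S n) : p V hV := by
  suffices h : ∃ h : V ∈ hSpace U S n, p V h from h.choose_spec
  refine Submodule.iSup_induction (motive := fun V => ∃ h : V ∈ hSpace U S n, p V h) _ hV
    (fun μ W hW => ?_) ⟨_, zero⟩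
    (fun V W ⟨hV, h1⟩ ⟨hW, h2⟩ => ⟨_, add V W hV hW h1 h2⟩)
  by_cases h : μ ∈ S
  · rw [iSup_pos h] at hW
    obtain ⟨P, hP, rfl⟩ := hW
    exact ⟨_, mem μ h P hP⟩
  · rw [iSup_neg h, Submodule.mem_bot] at hW
    subst hW
    exact ⟨_, zero⟩

lemma hSpace_lie_hSpace {S : Finset ℂ} {n : ℂ → ℕ} {V W : VF U} (hV : V ∈ hSpace U S n)
    (hW : W ∈ hSpace U S n) : ⁅V, W⁆ = 0 := by
  induction hV using hSpace_induction with
  | mem μ _ P _ =>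
    induction hW using hSpace_induction with
    | mem ν _ Q _ => exact expPoly_lie_expPoly _ _ _ _
    | zero => exact lie_zero _
    | add V W _ _ hV hW => rw [lie_add, hV, hW, add_zero]
  | zero => exact zero_lie _
  | add V W _ _ hV hW => rw [add_lie, hV, hW, add_zero]

lemma shear_lie_mem_hSpace (c : ℂ) {S : Finset ℂ} {n : ℂ → ℕ} {V : VF U}
    (hV : V ∈ hSpace U S n) : ⁅shear U c, V⁆ ∈ hSpace U S n := by
  induction hV using hSpace_induction with
  | mem μ hμ P hP =>
    rw [shear_lie_expPoly]
    exact quasiPoly_le_hSpace hμ (expPoly_mem_quasiPoly _ (shiftDeriv_mem_degreeLT _ hP))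
  | zero => rw [lie_zero]; exact zero_mem _
  | add V W _ _ hV hW => rw [lie_add]; exact add_mem hV hW

lemma xdx_lie_hSpace {S : Finset ℂ} {n : ℂ → ℕ} {V : VF U} (hV : V ∈ hSpace U S n) :
    ⁅xdx U, V⁆ = -V := by
  induction hV using hSpace_induction with
  | mem μ _ P _ => exact xdx_lie_expPoly _ _
  | zero => rw [lie_zero, neg_zero]
  | add V W _ _ hV hW => rw [lie_add, hV, hW]; abel

lemma expPoly_lie_hSpace (μ : ℂ) (P : ℂ[X]) {S : Finset ℂ} {n : ℂ → ℕ} {V : VF U}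
    (hV : V ∈ hSpace U S n) : ⁅expPoly U μ P, V⁆ = 0 := by
  induction hV using hSpace_induction with
  | mem ν _ Q _ => exact expPoly_lie_expPoly _ _ _ _
  | zero => exact lie_zero _
  | add V W _ _ hV hW => rw [lie_add, hV, hW, add_zero]

/-- Every element of `h` is a bracket of `c x ∂_x + ∂_y` with an element of
`h + ⟨y^N e^{c y} ∂_x⟩`. -/
lemma exists_shear_lie_eq (c : ℂ) {S : Finset ℂ} {n : ℂ → ℕ} {V : VF U}
    (hV : V ∈ hSpace U S n) :
    ∃ W ∈ hSpace U S n ⊔ ℂ ∙ (expPoly U c (X ^ mult S n c)), ⁅shear U c, W⁆ = V := by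
  induction hV using hSpace_induction with
  | mem μ hμ P hP =>
    by_cases h : μ = c
    · subst h
      -- For μ = c the operator is d/dy, and an antiderivative may have degree exactly n μ. This one
      -- extra dimension is spanned by y^N e^{cy}∂_x.
      obtain ⟨Q, hQ, rfl⟩ := exists_derivative_eq _ _ hP
      refine ⟨expPoly U μ Q, ?_, ?_⟩
      · rw [mult_of_mem hμ]
        have := expPoly_mem_quasiPoly (U := U) μ hQ
        rw [quasiPoly_succ] at this
        exact sup_le_sup_right (quasiPoly_le_hSpace hμ) _ this
      · rw [shear_lie_expPoly, shiftDeriv_apply]; simp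
    · obtain ⟨Q, hQ, rfl⟩ := exists_shiftDeriv_eq (sub_ne_zero.2 h) _ _ hP
      exact ⟨expPoly U μ Q, Submodule.mem_sup_left
        (quasiPoly_le_hSpace hμ (expPoly_mem_quasiPoly _ hQ)), shear_lie_expPoly _ _ _⟩
  | zero => exact ⟨0, zero_mem _, lie_zero _⟩
  | add V W _ _ hV hW =>
    obtain ⟨V', hV', rfl⟩ := hV
    obtain ⟨W', hW', rfl⟩ := hW
    exact ⟨V' + W', add_mem hV' hW', lie_add _ _ _⟩

lemma shear_lie_expPoly_X_pow_mem (c : ℂ) (S : Finset ℂ) (n : ℂ → ℕ) :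
    ⁅shear U c, expPoly U c (X ^ mult S n c)⁆ ∈ hSpace U S n := by
  rw [shear_lie_expPoly, shiftDeriv_apply, sub_self, C_0, zero_mul, zero_add]
  refine quasiPoly_mult_le S n c (expPoly_mem_quasiPoly _ (derivative_mem_degreeLT ?_))
  rw [mem_degreeLT, degree_X_pow]
  exact_mod_cast Nat.lt_succ_self _

/-! Nonempty domains. -/

/-- A vertical slice of the open set through one of its points is infinite, and a polynomial with
infinitely many roots is zero. -/
lemma expPoly_injective (hU : (U : Set (ℂ × ℂ)).Nonempty) (μ : ℂ) :
    Function.Injective (expPoly U μ) := by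
  rw [← LinearMap.ker_eq_bot, LinearMap.ker_eq_bot']
  intro P hP
  obtain ⟨⟨x, y⟩, hp⟩ := hU
  have hopen : IsOpen {z : ℂ | (x, z) ∈ U} := U.isOpen.preimage (by fun_prop)
  have hinf : Set.Infinite {z : ℂ | (x, z) ∈ U} := infinite_of_mem_nhds y (hopen.mem_nhds hp)
  refine Polynomial.eq_zero_of_infinite_isRoot P (hinf.mono fun z hz => ?_)
  have h := expPoly_apply μ P hz
  rw [hP] at h
  have h' : (0 : ℂ) = Complex.exp (μ * z) * P.eval z := congrArg Prod.fst h
  simpa [Complex.exp_ne_zero] using h'.symm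

instance (μ : ℂ) (m : ℕ) : FiniteDimensional ℂ (quasiPoly U μ m) := by
  have : FiniteDimensional ℂ (degreeLT ℂ m) := (degreeLTEquiv ℂ m).symm.finiteDimensional
  exact inferInstanceAs (FiniteDimensional ℂ ((degreeLT ℂ m).map (expPoly U μ)))

instance (S : Finset ℂ) (n : ℂ → ℕ) : FiniteDimensional ℂ (hSpace U S n) := by
  have h := Submodule.finiteDimensional_finset_sup S (fun μ => quasiPoly U μ (n μ))
  rwa [Finset.sup_eq_iSup] at h

lemma finrank_quasiPoly_le (μ : ℂ) (m : ℕ) : Module.finrank ℂ (quasiPoly U μ m) ≤ m := by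
  have : FiniteDimensional ℂ (degreeLT ℂ m) := (degreeLTEquiv ℂ m).symm.finiteDimensional
  refine (Submodule.finrank_map_le _ _).trans ?_
  rw [(degreeLTEquiv ℂ m).finrank_eq, Module.finrank_fin_fun]

lemma finrank_quasiPoly (hU : (U : Set (ℂ × ℂ)).Nonempty) (μ : ℂ) (m : ℕ) :
    Module.finrank ℂ (quasiPoly U μ m) = m := by
  rw [quasiPoly, ← (Submodule.equivMapOfInjective _ (expPoly_injective hU μ) _).finrank_eq,
    (degreeLTEquiv ℂ m).finrank_eq,
    Module.finrank_fin_fun]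

/-! ### Generalized eigenspaces and the multiplicity N -/

lemma quasiPoly_le_maxGenEigenspace (c μ : ℂ) (m : ℕ) :
    quasiPoly U μ m ≤
      Module.End.maxGenEigenspace (LieAlgebra.ad ℂ (VF U) (shear U c)) (μ - c) := by
  rintro _ ⟨P, hP, rfl⟩
  rw [Module.End.mem_maxGenEigenspace]
  refine ⟨m, ?_⟩
  induction m generalizing P with
  | zero =>
    have : P = 0 := by simpa [mem_degreeLT] using hP
    simp [this]
  | succ m ih =>
    rw [pow_succ, Module.End.mul_apply]
    -- Subtracting the eigenvalue μ - c leaves d/dy on the polynomial factor, which kills degree < m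
    -- after m steps.
    have : (LieAlgebra.ad ℂ (VF U) (shear U c) - (μ - c) • 1) (expPoly U μ P) =
        expPoly U μ (derivative P) := by
      simp only [LinearMap.sub_apply, LieAlgebra.ad_apply, LinearMap.smul_apply,
        Module.End.one_apply]
      rw [shear_lie_expPoly, shiftDeriv_apply, ← map_smul, ← map_sub, smul_eq_C_mul]
      simp
    rw [this]
    exact ih _ (derivative_mem_degreeLT hP)

lemma hSpace_inf_maxGenEigenspace (c : ℂ) (S : Finset ℂ) (n : ℂ → ℕ) :
    hSpace U S n ⊓ Module.End.maxGenEigenspace (LieAlgebra.ad ℂ (VF U) (shear U c)) 0 =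
      quasiPoly U c (mult S n c) := by
  set E := fun μ => Module.End.maxGenEigenspace (LieAlgebra.ad ℂ (VF U) (shear U c)) μ with hE
  apply le_antisymm
  · rintro V ⟨hV, hV0⟩
    -- Every V(μ) with μ ≠ c belongs to a nonzero eigenvalue, so independence of the generalized
    -- eigenspaces leaves only V(c) over zero.
    have h1 : hSpace U S n ≤ quasiPoly U c (mult S n c) ⊔ ⨆ ν ≠ (0 : ℂ), E ν := by
      refine iSup₂_le fun μ hμ => ?_
      by_cases h : μ = c
      · subst h; rw [mult_of_mem hμ]; exact le_sup_left
      · exact (quasiPoly_le_maxGenEigenspace c μ _).trans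
          ((le_iSup₂_of_le (f := fun ν (_ : ν ≠ (0 : ℂ)) => E ν) (μ - c)
            (sub_ne_zero.2 h) le_rfl).trans le_sup_right)
    obtain ⟨A, hA, B, hB, rfl⟩ := Submodule.mem_sup.1 (h1 hV)
    have hA0 : A ∈ E 0 := by simpa [hE] using quasiPoly_le_maxGenEigenspace c c _ hA
    have hB0 : B ∈ E 0 := by simpa [hE] using sub_mem hV0 hA0
    have hind : iSupIndep E := Module.End.independent_maxGenEigenspace _
    have : B = 0 := Submodule.disjoint_def.1 (hind 0) B hB0 hB
    rw [this, add_zero]; exact hA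
  · refine le_inf (quasiPoly_mult_le S n c) ?_
    simpa using quasiPoly_le_maxGenEigenspace (U := U) c c (mult S n c)

lemma zeroMultiplicityOn_shear (hU : (U : Set (ℂ × ℂ)).Nonempty) (c : ℂ) (S : Finset ℂ)
    (n : ℂ → ℕ) : zeroMultiplicityOn (shear U c) (hSpace U S n) = mult S n c := by
  have := hSpace_inf_maxGenEigenspace (U := U) c S n
  rw [zeroMultiplicityOn, this, finrank_quasiPoly hU]

/-- If zero is not an eigenvalue, every element of `h` is a bracket of `X` with an element of `h`. -/
lemma exists_shear_lie_eq_of_not_zeroEigenvalueOn {c : ℂ} {S : Finset ℂ} {n : ℂ → ℕ}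
    (h : ¬ ZeroEigenvalueOn (shear U c) (hSpace U S n)) {V : VF U} (hV : V ∈ hSpace U S n) :
    ∃ W ∈ hSpace U S n, ⁅shear U c, W⁆ = V := by
  let T : hSpace U S n →ₗ[ℂ] hSpace U S n :=
    (LieAlgebra.ad ℂ (VF U) (shear U c)).restrict fun _ => shear_lie_mem_hSpace c
  have hT : Function.Injective T := by
    rw [← LinearMap.ker_eq_bot, LinearMap.ker_eq_bot']
    intro W hW
    by_contra h0
    exact h ⟨W, W.2, fun h' => h0 (Subtype.ext h'), congrArg Subtype.val hW⟩
  obtain ⟨W, hW⟩ := LinearMap.injective_iff_surjective.1 hT ⟨V, hV⟩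
  exact ⟨W, W.2, congrArg Subtype.val hW⟩

/-! ### The six spans are Lie algebras with commutator algebra h -/

lemma commutatorAlgebra_toSubmodule {L : Type*} [LieRing L] [LieAlgebra ℂ L]
    (g : LieSubalgebra ℂ L) :
    (commutatorAlgebra g).toSubmodule = Submodule.span ℂ {Z | ∃ V ∈ g, ∃ W ∈ g, ⁅V, W⁆ = Z} := by
  have h : (LieAlgebra.derivedSeries ℂ g 1).toSubmodule =
      Submodule.span ℂ {Z : g | ∃ V W : g, ⁅V, W⁆ = Z} := by
    rw [LieAlgebra.derivedSeries_def, LieAlgebra.derivedSeriesOfIdeal_succ,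
      LieAlgebra.derivedSeriesOfIdeal_zero, LieSubmodule.lieIdeal_oper_eq_linear_span']
    simp
  change (LieAlgebra.derivedSeries ℂ g 1).toSubmodule.map (g.incl : g →ₗ[ℂ] L) = _
  rw [h, Submodule.map_span]
  congr 1
  ext Z
  constructor
  · rintro ⟨_, ⟨V, W, rfl⟩, rfl⟩
    exact ⟨V, V.2, W, W.2, rfl⟩
  · rintro ⟨V, hV, W, hW, rfl⟩
    exact ⟨_, ⟨⟨V, hV⟩, ⟨W, hW⟩, rfl⟩, rfl⟩

lemma lie_mem_commutatorAlgebra {L : Type*} [LieRing L] [LieAlgebra ℂ L]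
    {g : LieSubalgebra ℂ L} {V W : L} (hV : V ∈ g) (hW : W ∈ g) : ⁅V, W⁆ ∈ commutatorAlgebra g := by
  rw [← LieSubalgebra.mem_toSubmodule, commutatorAlgebra_toSubmodule]
  exact Submodule.subset_span ⟨V, hV, W, hW, rfl⟩

lemma commutatorAlgebra_le {L : Type*} [LieRing L] [LieAlgebra ℂ L]
    (g : LieSubalgebra ℂ L) : commutatorAlgebra g ≤ g := by
  rintro _ ⟨V, _, rfl⟩
  exact V.2

/-- Extension of an abelian subalgebra `h` by a set `T` of elements which act on `h`, with
brackets in `h`. -/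
lemma exists_lieSubalgebra_sup_span {L : Type*} [LieRing L] [LieAlgebra ℂ L]
    {h : Submodule ℂ L} {T : Set L} (h0 : ∀ V ∈ h, ∀ W ∈ h, ⁅V, W⁆ = 0)
    (h1 : ∀ t ∈ T, ∀ V ∈ h, ⁅t, V⁆ ∈ h) (h2 : ∀ t ∈ T, ∀ s ∈ T, ⁅t, s⁆ ∈ h)
    (h3 : ∀ V ∈ h, ∃ t ∈ T, ∃ W ∈ h ⊔ Submodule.span ℂ T, ∃ c : ℂ, c • ⁅t, W⁆ = V) :
    ∃ k : LieSubalgebra ℂ L, k.toSubmodule = h ⊔ Submodule.span ℂ T ∧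
      (commutatorAlgebra k).toSubmodule = h := by
  have h4 : ∀ t ∈ T, ∀ W ∈ h ⊔ Submodule.span ℂ T, ⁅t, W⁆ ∈ h := by
    intro t ht W hW
    have : h ⊔ Submodule.span ℂ T ≤ h.comap (LieAlgebra.ad ℂ L t : L →ₗ[ℂ] L) :=
      sup_le (fun V hV => h1 t ht V hV) (Submodule.span_le.2 fun s hs => h2 t ht s hs)
    exact this hW
  have h5 : ∀ V ∈ h ⊔ Submodule.span ℂ T, ∀ W ∈ h ⊔ Submodule.span ℂ T, ⁅V, W⁆ ∈ h := by
    intro V hV W hW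
    have h6 : ∀ V ∈ h, ⁅W, V⁆ ∈ h := by
      intro V hV
      have : h ⊔ Submodule.span ℂ T ≤ h.comap (LieAlgebra.ad ℂ L V : L →ₗ[ℂ] L) := by
        refine sup_le (fun V' hV' => ?_) (Submodule.span_le.2 fun s hs => ?_)
        · change ⁅V, V'⁆ ∈ h
          rw [h0 V hV V' hV']; exact zero_mem _
        · change ⁅V, s⁆ ∈ h
          rw [← lie_skew]; exact neg_mem (h1 s hs V hV)
      rw [← lie_skew]; exact neg_mem (this hW)
    have : h ⊔ Submodule.span ℂ T ≤ h.comap (LieAlgebra.ad ℂ L W : L →ₗ[ℂ] L) := by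
      refine sup_le (fun V' hV' => h6 V' hV') (Submodule.span_le.2 fun s hs => ?_)
      change ⁅W, s⁆ ∈ h
      rw [← lie_skew]; exact neg_mem (h4 s hs W hW)
    rw [← lie_skew]; exact neg_mem (this hV)
  refine ⟨{ toSubmodule := h ⊔ Submodule.span ℂ T
            lie_mem' := fun {V W} hV hW => Submodule.mem_sup_left (h5 V hV W hW) }, rfl, ?_⟩
  rw [commutatorAlgebra_toSubmodule]
  apply le_antisymm
  · rw [Submodule.span_le]
    rintro _ ⟨V, hV, W, hW, rfl⟩
    exact h5 V hV W hW
  · intro V hV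
    obtain ⟨t, ht, W, hW, c, rfl⟩ := h3 V hV
    exact Submodule.smul_mem _ _ (Submodule.subset_span
      ⟨t, Submodule.mem_sup_right (Submodule.subset_span ht), W, hW, rfl⟩)

lemma shear_lie_xdx (c : ℂ) : ⁅shear U c, xdx U⁆ = 0 := by
  simp [shear, add_lie, smul_lie, dy_lie_xdx]

section NormalForms

variable (c : ℂ) (S : Finset ℂ) (n : ℂ → ℕ)

lemma exists_lieSubalgebra_shear (hc : ¬ ZeroEigenvalueOn (shear U c) (hSpace U S n)) :
    ∃ k : LieSubalgebra ℂ (VF U), k.toSubmodule = hSpace U S n ⊔ Submodule.span ℂ {shear U c} ∧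
      (commutatorAlgebra k).toSubmodule = hSpace U S n := by
  refine exists_lieSubalgebra_sup_span (fun V hV W hW => hSpace_lie_hSpace hV hW) ?_ ?_ ?_
  · rintro t rfl V hV
    exact shear_lie_mem_hSpace c hV
  · rintro t rfl s rfl
    rw [lie_self]; exact zero_mem _
  · intro V hV
    obtain ⟨W, hW, rfl⟩ := exists_shear_lie_eq_of_not_zeroEigenvalueOn hc hV
    exact ⟨_, rfl, W, Submodule.mem_sup_left hW, 1, one_smul _ _⟩

lemma exists_lieSubalgebra_shear_expPoly :
    ∃ k : LieSubalgebra ℂ (VF U), k.toSubmodule = hSpace U S n ⊔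
        Submodule.span ℂ {shear U c, expPoly U c (X ^ mult S n c)} ∧
      (commutatorAlgebra k).toSubmodule = hSpace U S n := by
  have h := shear_lie_expPoly_X_pow_mem (U := U) c S n
  refine exists_lieSubalgebra_sup_span (fun V hV W hW => hSpace_lie_hSpace hV hW) ?_ ?_ ?_
  · rintro t (rfl | rfl) V hV
    · exact shear_lie_mem_hSpace c hV
    · rw [expPoly_lie_hSpace _ _ hV]; exact zero_mem _
  · rintro t (rfl | rfl) s (rfl | rfl)
    · rw [lie_self]; exact zero_mem _
    · exact h
    · rw [← lie_skew]; exact neg_mem h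
    · rw [lie_self]; exact zero_mem _
  · intro V hV
    obtain ⟨W, hW, rfl⟩ := exists_shear_lie_eq c hV
    have hle : ({expPoly U c (X ^ mult S n c)} : Set (VF U)) ⊆
        {shear U c, expPoly U c (X ^ mult S n c)} := Set.subset_insert _ _
    have hle' := sup_le_sup_left (Submodule.span_mono (R := ℂ) hle) (hSpace U S n)
    exact ⟨_, Or.inl rfl, W, hle' hW, 1, one_smul _ _⟩

/-- The second generator acts on h as -1, so its brackets alone already fill h, whatever the
eigenvalues of the first. The values (c, d) = (0, 0) and (1, 1) give forms 2 and 6. -/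
lemma exists_lieSubalgebra_shear_xdx (d : ℂ) :
    ∃ k : LieSubalgebra ℂ (VF U), k.toSubmodule = hSpace U S n ⊔
        Submodule.span ℂ {shear U c, xdx U + d • expPoly U c (X ^ mult S n c)} ∧
      (commutatorAlgebra k).toSubmodule = hSpace U S n := by
  have h : ⁅shear U c, xdx U + d • expPoly U c (X ^ mult S n c)⁆ ∈ hSpace U S n := by
    rw [lie_add, shear_lie_xdx, zero_add, lie_smul]
    exact Submodule.smul_mem _ _ (shear_lie_expPoly_X_pow_mem c S n)
  have h' : ∀ V ∈ hSpace U S n, ⁅xdx U + d • expPoly U c (X ^ mult S n c), V⁆ = -V := by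
    intro V hV
    rw [add_lie, smul_lie, expPoly_lie_hSpace _ _ hV, xdx_lie_hSpace hV]; simp
  refine exists_lieSubalgebra_sup_span (fun V hV W hW => hSpace_lie_hSpace hV hW) ?_ ?_ ?_
  · rintro t (rfl | rfl) V hV
    · exact shear_lie_mem_hSpace c hV
    · rw [h' V hV]; exact neg_mem hV
  · rintro t (rfl | rfl) s (rfl | rfl)
    · rw [lie_self]; exact zero_mem _
    · exact h
    · rw [← lie_skew]; exact neg_mem h
    · rw [lie_self]; exact zero_mem _
  · intro V hV
    exact ⟨_, Or.inr rfl, V, Submodule.mem_sup_left hV, -1, by rw [h' V hV]; simp⟩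

end NormalForms

/-- Replaces the multiplicities, which are dimensions, by the explicit numbers `mult S n c`. The
domain must be nonempty for this: over the empty set all fields vanish and the dimensions drop to
zero. -/
lemma isNormalForm_iff (hU : (U : Set (ℂ × ℂ)).Nonempty) {S : Finset ℂ} {n : ℂ → ℕ}
    {F : Submodule ℂ (VF U)} : IsNormalForm S n F ↔
      (¬ ZeroEigenvalueOn (shear U 0) (hSpace U S n) ∧
        F = hSpace U S n ⊔ Submodule.span ℂ {shear U 0}) ∨
      (F = hSpace U S n ⊔ Submodule.span ℂ {shear U 0, xdx U}) ∨
      (F = hSpace U S n ⊔ Submodule.span ℂ {shear U 0, expPoly U 0 (X ^ mult S n 0)}) ∨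
      (¬ ZeroEigenvalueOn (shear U 1) (hSpace U S n) ∧
        F = hSpace U S n ⊔ Submodule.span ℂ {shear U 1}) ∨
      (F = hSpace U S n ⊔ Submodule.span ℂ {shear U 1, expPoly U 1 (X ^ mult S n 1)}) ∨
      (0 < mult S n 1 ∧ F = hSpace U S n ⊔
        Submodule.span ℂ {shear U 1, xdx U + expPoly U 1 (X ^ mult S n 1)}) := by
  rw [← zeroMultiplicityOn_shear hU, ← zeroMultiplicityOn_shear hU, shear_zero, shear_one]
  rfl

lemma IsNormalForm.exists_lieSubalgebra {S : Finset ℂ} {n : ℂ → ℕ} {F : Submodule ℂ (VF U)}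
    (hF : IsNormalForm S n F) : ∃ k : LieSubalgebra ℂ (VF U), k.toSubmodule = F ∧
      (commutatorAlgebra k).toSubmodule = hSpace U S n := by
  rcases Set.eq_empty_or_nonempty (U : Set (ℂ × ℂ)) with hU | hU
  · have : Subsingleton (VF U) := ⟨fun V W => VF.ext_on fun p hp => by
      rw [← SetLike.mem_coe, hU] at hp; exact hp.elim⟩
    exact ⟨⊥, Subsingleton.elim _ _, Subsingleton.elim _ _⟩
  · rcases (isNormalForm_iff hU).1 hF with ⟨h, rfl⟩ | rfl | rfl | ⟨h, rfl⟩ | rfl | ⟨h, rfl⟩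
    · exact exists_lieSubalgebra_shear 0 S n h
    · simpa using exists_lieSubalgebra_shear_xdx (U := U) 0 S n 0
    · exact exists_lieSubalgebra_shear_expPoly 0 S n
    · exact exists_lieSubalgebra_shear 1 S n h
    · exact exists_lieSubalgebra_shear_expPoly 1 S n
    · simpa using exists_lieSubalgebra_shear_xdx (U := U) 1 S n 1

/-! ### Fields w(y)∂_x and the shape of g' -/

variable (U) in
/-- The vector field `∂_x`. -/
def dx : VF U := expPoly U 0 1

lemma dx_apply {p : ℂ × ℂ} (hp : p ∈ U) : (dx U).1 p = (1, 0) := by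
  rw [dx, expPoly_apply _ _ hp]; simp

lemma dx_lie_apply (V : VF U) {p : ℂ × ℂ} (hp : p ∈ U) :
    (⁅dx U, V⁆ : VF U).1 p = fderiv ℂ V.1 p (1, 0) := by
  rw [VF.bracket_eq _ _ hp, dx, fderiv_expPoly _ _ hp, ← dx, dx_apply hp]; simp

lemma dy_lie_dx : ⁅dy U, dx U⁆ = 0 := by
  rw [dx, dy_lie_expPoly]; simp

lemma dx_lie_xdx : ⁅dx U, xdx U⁆ = dx U := by
  rw [← lie_skew, dx, xdx_lie_expPoly, neg_neg]

lemma fderiv_apply_eq (V : VF U) {p : ℂ × ℂ} (hp : p ∈ U) (v : ℂ × ℂ) :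
    fderiv ℂ V.1 p v = v.1 • (⁅dx U, V⁆ : VF U).1 p + v.2 • (⁅dy U, V⁆ : VF U).1 p := by
  rw [dx_lie_apply _ hp, dy_lie_apply _ hp, ← map_smul, ← map_smul, ← map_add]
  simp

/-- On a connected open set, a function of a field with vanishing derivatives is constant. -/
lemma exists_eq_const (hU : IsPreconnected (U : Set (ℂ × ℂ))) {f : ℂ × ℂ → ℂ × ℂ}
    (hf : DifferentiableOn ℂ f U) (hx : ∀ p ∈ U, fderiv ℂ f p (1, 0) = 0)
    (hy : ∀ p ∈ U, fderiv ℂ f p (0, 1) = 0) : ∃ a, ∀ p ∈ U, f p = a := by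
  refine U.isOpen.exists_is_const_of_fderiv_eq_zero hU hf fun p hp => ?_
  ext <;> simp [hx p hp, hy p hp]

lemma VF.differentiableOn (V : VF U) : DifferentiableOn ℂ V.1 U :=
  V.2.1.differentiableOn (by simp)

variable (U) in
/-- The vector fields `w ∂_x` with `∂w/∂x = 0`. -/
def yFields : Submodule ℂ (VF U) where
  carrier := {W | (∀ p ∈ U, (W.1 p).2 = 0) ∧ ⁅dx U, W⁆ = 0}
  add_mem' := by
    rintro V W ⟨hV, hV'⟩ ⟨hW, hW'⟩
    exact ⟨fun p hp => by simp [VF.coe_add_apply, hV p hp, hW p hp],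
      by rw [lie_add, hV', hW', add_zero]⟩
  zero_mem' := ⟨fun _ _ => rfl, lie_zero _⟩
  smul_mem' := by
    rintro c V ⟨hV, hV'⟩
    exact ⟨fun p hp => by simp [VF.coe_smul_apply, hV p hp], by rw [lie_smul, hV', smul_zero]⟩

lemma expPoly_mem_yFields (μ : ℂ) (P : ℂ[X]) : expPoly U μ P ∈ yFields U :=
  ⟨fun p hp => by rw [expPoly_apply _ _ hp], expPoly_lie_expPoly _ _ _ _⟩

lemma hSpace_le_yFields (S : Finset ℂ) (n : ℂ → ℕ) : hSpace U S n ≤ yFields U :=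
  fun _ hV => hSpace_induction (p := fun V _ => V ∈ yFields U)
    (fun _ _ _ _ => expPoly_mem_yFields _ _) (zero_mem _)
    (fun _ _ _ _ h1 h2 => add_mem h1 h2) hV

/-- The field e^{-μy}W has vanishing x- and y-derivatives, hence is constant. -/
lemma exists_eq_expPoly_C (hU : IsPreconnected (U : Set (ℂ × ℂ))) {W : VF U}
    (hW : W ∈ yFields U) {μ : ℂ} (h : ⁅dy U, W⁆ = μ • W) : ∃ c : ℂ, W = expPoly U μ (C c) := by
  let f : ℂ × ℂ → ℂ × ℂ := fun p => Complex.exp (-μ * p.2) • W.1 p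
  have hd : ∀ p ∈ U, HasFDerivAt f (Complex.exp (-μ * p.2) • fderiv ℂ W.1 p +
      ((Complex.exp (-μ * p.2) • (-μ • ContinuousLinearMap.snd ℂ ℂ ℂ)).smulRight (W.1 p))) p :=
    fun p hp => HasFDerivAt.smul ((hasFDerivAt_snd.const_mul (-μ)).cexp)
      (VF.differentiableAt W hp).hasFDerivAt
  obtain ⟨a, ha⟩ := exists_eq_const (f := f) hU
    (fun p hp => (hd p hp).differentiableAt.differentiableWithinAt)
    (fun p hp => by rw [(hd p hp).fderiv]; simp [← dx_lie_apply W hp, hW.2]) fun p hp => by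
      rw [(hd p hp).fderiv]
      simp [← dy_lie_apply W hp, h, VF.coe_smul_apply, smul_smul, mul_comm]
  refine ⟨a.1, VF.ext_on fun p hp => ?_⟩
  rw [expPoly_apply _ _ hp, ← ha p hp]
  have : Complex.exp (μ * p.2) * Complex.exp (-(μ * p.2)) = 1 := by
    rw [← Complex.exp_add]; simp
  ext
  · simp [f, ← mul_assoc, this]
  · exact hW.1 p hp

/-- A function of `y` annihilated by `(∂_y - μ)^k` is `e^{μ y} P(y)` with `deg P < k`. -/
lemma mem_quasiPoly_of_pow_eq_zero (hU : IsPreconnected (U : Set (ℂ × ℂ)))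
    {A : Submodule ℂ (VF U)} (hA : A ≤ yFields U) (hD : ∀ W ∈ A, ⁅dy U, W⁆ ∈ A) (μ : ℂ) (k : ℕ)
    {W : VF U} (hW : W ∈ A)
    (h : ((LieAlgebra.ad ℂ (VF U) (dy U) - μ • 1 : Module.End ℂ (VF U)) ^ k) W = 0) :
    W ∈ quasiPoly U μ k := by
  induction k generalizing W with
  | zero => simp_all
  | succ k ih =>
    rw [pow_succ, Module.End.mul_apply] at h
    have e : (LieAlgebra.ad ℂ (VF U) (dy U) - μ • 1 : Module.End ℂ (VF U)) W =
      ⁅dy U, W⁆ - μ • W := rfl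
    rw [e] at h
    obtain ⟨P, hP, hPW⟩ := ih (sub_mem (hD W hW) (A.smul_mem μ hW)) h
    -- Variation of constants: if (∂_y - μ)W = e^{μy}Q'(y)∂_x, then W - e^{μy}Q(y)∂_x is killed by
    -- ∂_y - μ.
    obtain ⟨Q, hQ, rfl⟩ := exists_derivative_eq k P hP
    obtain ⟨c, hc⟩ := exists_eq_expPoly_C hU (μ := μ)
      (sub_mem (hA hW) (expPoly_mem_yFields μ Q)) (by
        rw [lie_sub, dy_lie_expPoly, map_add, hPW, ← smul_eq_C_mul, map_smul, smul_sub]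
        abel)
    rw [sub_eq_iff_eq_add] at hc
    rw [hc]
    refine add_mem (expPoly_mem_quasiPoly _ ?_) (expPoly_mem_quasiPoly _ hQ)
    rw [mem_degreeLT]
    exact degree_C_le.trans_lt (by exact_mod_cast Nat.succ_pos k)

/-- By Cayley–Hamilton: on the generalized eigenspace T - μ is nilpotent, so its characteristic
polynomial is a power of X with exponent the dimension. This exponent is the degree bound that makes
the dimension count for V(μ) exact. -/
lemma pow_finrank_maxGenEigenspace_apply_eq_zero {M : Type*} [AddCommGroup M] [Module ℂ M]
    [FiniteDimensional ℂ M] (T : Module.End ℂ M) (μ : ℂ) {w : M}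
    (hw : w ∈ T.maxGenEigenspace μ) :
    ((T - μ • 1) ^ Module.finrank ℂ (T.maxGenEigenspace μ)) w = 0 := by
  have hmaps : Set.MapsTo (T - algebraMap ℂ (Module.End ℂ M) μ) (T.maxGenEigenspace μ)
      (T.maxGenEigenspace μ) :=
    Module.End.mapsTo_maxGenEigenspace_of_comm (Algebra.mul_sub_algebraMap_commutes T μ) μ
  have hnil := Module.End.isNilpotent_restrict_maxGenEigenspace_sub_algebraMap T μ hmaps
  have h := LinearMap.aeval_self_charpoly ((T - algebraMap ℂ (Module.End ℂ M) μ).restrict hmaps)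
  rw [IsNilpotent.charpoly_eq_X_pow_finrank hnil] at h
  rw [map_pow, aeval_X] at h
  have hpow : ∀ (k : ℕ) (w : T.maxGenEigenspace μ),
      ((((T - algebraMap ℂ (Module.End ℂ M) μ).restrict hmaps) ^ k) w : M) =
        ((T - μ • 1) ^ k) w := by
    intro k
    induction k with
    | zero => intro w; rfl
    | succ k ih => intro w; rw [pow_succ, pow_succ, Module.End.mul_apply, ih]; rfl
  rw [← hpow _ ⟨w, hw⟩, h]; rfl

/-- A finite-dimensional space of fields `w(y) ∂_x` invariant under `∂_y` is one of the `h`. -/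
lemma exists_eq_hSpace (hU : IsPreconnected (U : Set (ℂ × ℂ)))
    {A : Submodule ℂ (VF U)} [FiniteDimensional ℂ A] (hA : A ≤ yFields U)
    (hD : ∀ W ∈ A, ⁅dy U, W⁆ ∈ A) :
    ∃ (S : Finset ℂ) (n : ℂ → ℕ), (∀ μ ∈ S, 0 < n μ) ∧ A = hSpace U S n := by
  let T : Module.End ℂ A := (LieAlgebra.ad ℂ (VF U) (dy U) : VF U →ₗ[ℂ] VF U).restrict hD
  have hT : ∀ (μ : ℂ) (k : ℕ) (W : A), (((T - μ • 1) ^ k) W : VF U) =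
      ((LieAlgebra.ad ℂ (VF U) (dy U) - μ • 1 : Module.End ℂ (VF U)) ^ k) W := by
    intro μ k
    induction k with
    | zero => intro W; rfl
    | succ k ih => intro W; rw [pow_succ, pow_succ, Module.End.mul_apply, ih]; rfl
  let n : ℂ → ℕ := fun μ => Module.finrank ℂ (T.maxGenEigenspace μ)
  have hG : ∀ μ, (T.maxGenEigenspace μ).map A.subtype = quasiPoly U μ (n μ) := by
    intro μ
    -- The eigenspace has dimension n μ and sits in V(μ), whose dimension is at most n μ.
    apply Submodule.eq_of_le_of_finrank_le
    · rintro _ ⟨W, hW, rfl⟩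
      refine mem_quasiPoly_of_pow_eq_zero hU hA hD μ _ W.2 ?_
      have := congrArg Subtype.val (pow_finrank_maxGenEigenspace_apply_eq_zero T μ hW)
      rwa [hT] at this
    · refine (finrank_quasiPoly_le _ _).trans ?_
      rw [← (Submodule.equivMapOfInjective _ A.injective_subtype _).finrank_eq]
  have hfin : {μ | T.maxGenEigenspace μ ≠ ⊥}.Finite :=
    WellFoundedGT.finite_ne_bot_of_iSupIndep T.independent_maxGenEigenspace
  refine ⟨hfin.toFinset, n, fun μ hμ => ?_, ?_⟩
  · rw [Set.Finite.mem_toFinset] at hμ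
    exact Nat.pos_of_ne_zero fun h => hμ (Submodule.finrank_eq_zero.1 h)
  · have htop := Module.End.iSup_maxGenEigenspace_eq_top T
    have hA' : A = ⨆ μ, quasiPoly U μ (n μ) := by
      simp_rw [← hG]
      rw [← Submodule.map_iSup, htop, Submodule.map_subtype_top]
    apply le_antisymm
    · conv_lhs => rw [hA']
      refine iSup_le fun μ => ?_
      by_cases h : μ ∈ hfin.toFinset
      · exact quasiPoly_le_hSpace h
      · rw [Set.Finite.mem_toFinset] at h
        have h := not_not.1 h
        rw [← hG, h, Submodule.map_bot]; exact bot_le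
    · rw [hSpace]
      refine iSup₂_le fun μ _ => ?_
      conv_rhs => rw [hA']
      exact le_iSup (fun μ => quasiPoly U μ (n μ)) μ

/-! ### The normalizer of the fields w(y)∂_x -/

lemma fderiv_snd_comp (V : VF U) {p : ℂ × ℂ} (hp : p ∈ U) (v : ℂ × ℂ) :
    fderiv ℂ (fun q => (V.1 q).2) p v = (fderiv ℂ V.1 p v).2 := by
  have := (VF.differentiableAt V hp).hasFDerivAt.snd
  rw [this.fderiv]; rfl

lemma fderiv_snd_eq_zero {V : VF U} (hV : ∀ p ∈ U, (V.1 p).2 = 0) {p : ℂ × ℂ} (hp : p ∈ U)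
    (v : ℂ × ℂ) : (fderiv ℂ V.1 p v).2 = 0 := by
  rw [← fderiv_snd_comp V hp]
  have : (fun q => (V.1 q).2) =ᶠ[nhds p] fun _ => 0 :=
    Filter.eventuallyEq_of_mem (U.isOpen.mem_nhds hp) hV
  rw [this.fderiv_eq]; simp

/-- The bracket of `v ∂_x` and `w ∂_x` when `v` is a function of `y`. -/
lemma lie_apply_of_mem_yFields {V W : VF U} (hV : V ∈ yFields U) (hW : ∀ p ∈ U, (W.1 p).2 = 0)
    {p : ℂ × ℂ} (hp : p ∈ U) : (⁅V, W⁆ : VF U).1 p = (V.1 p).1 • (⁅dx U, W⁆ : VF U).1 p := by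
  rw [VF.bracket_eq _ _ hp, fderiv_apply_eq W hp, fderiv_apply_eq V hp, hV.2, hV.1 p hp, hW p hp,
    zero_smul, zero_smul, add_zero, add_zero]
  simp [show ((0 : VF U).1 p) = 0 from rfl]

/-- Here [v∂_x, w∂_x] = v w_x ∂_x, and v can be cancelled. -/
lemma mem_yFields_of_lie_eq_zero {V W : VF U} (hV : V ∈ yFields U)
    (hV0 : ∀ p ∈ U, (V.1 p).1 ≠ 0) (hW : ∀ p ∈ U, (W.1 p).2 = 0) (h : ⁅V, W⁆ = 0) :
    W ∈ yFields U := by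
  refine ⟨hW, VF.ext_on fun p hp => ?_⟩
  have := lie_apply_of_mem_yFields hV hW hp
  rw [h] at this
  exact (smul_eq_zero.1 this.symm).resolve_left (hV0 p hp)

/-- The fields which normalize the algebra of fields `w(y) ∂_x`, up to a field `w(y) ∂_x`. -/
lemma exists_sub_mem_yFields (hU : IsPreconnected (U : Set (ℂ × ℂ))) {V Y : VF U}
    (hV : V ∈ yFields U) (hV0 : ∀ p ∈ U, (V.1 p).1 ≠ 0) (hVY : ⁅V, Y⁆ ∈ yFields U)
    (hVdy : ⁅V, dy U⁆ ∈ yFields U) (hdy : ⁅dy U, Y⁆ ∈ yFields U) :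
    ∃ q a : ℂ, Y - q • dy U - a • xdx U ∈ yFields U := by
  have hYx : ∀ p ∈ U, (fderiv ℂ Y.1 p (1, 0)).2 = 0 := by
    intro p hp
    have h := hVY.1 p hp
    have hV' : V.1 p = (V.1 p).1 • ((1, 0) : ℂ × ℂ) := by
      ext
      · simp
      · simp [hV.1 p hp]
    rw [VF.bracket_eq _ _ hp, Prod.snd_sub, fderiv_snd_eq_zero hV.1 hp, sub_zero, hV', map_smul,
      Prod.smul_snd] at h
    exact (smul_eq_zero.1 h).resolve_left (hV0 p hp)
  have hYy : ∀ p ∈ U, (fderiv ℂ Y.1 p (0, 1)).2 = 0 := by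
    intro p hp
    rw [← dy_lie_apply Y hp]
    exact hdy.1 p hp
  -- The ∂_y-components of [V, Y] and [∂_y, Y] are v Q_x and Q_y, where Q is that of Y. Both vanish,
  -- so Q is a constant q.
  obtain ⟨q, hq⟩ := exists_eq_const (f := fun p => ((0 : ℂ), (Y.1 p).2)) hU
    (fun p hp => ((differentiableAt_const _).prodMk
      (VF.differentiableAt Y hp).snd).differentiableWithinAt)
    (fun p hp => by
      rw [((hasFDerivAt_const (0 : ℂ) p).prodMk (VF.differentiableAt Y hp).hasFDerivAt.snd).fderiv]
      simp [hYx p hp])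
    (fun p hp => by
      rw [((hasFDerivAt_const (0 : ℂ) p).prodMk (VF.differentiableAt Y hp).hasFDerivAt.snd).fderiv]
      simp [hYy p hp])
  refine ⟨q.2, ?_⟩
  set Y' := Y - q.2 • dy U with hY'
  have hY'0 : ∀ p ∈ U, (Y'.1 p).2 = 0 := by
    intro p hp
    rw [hY', VF.coe_sub_apply, VF.coe_smul_apply, dy_apply hp, ← hq p hp]; simp
  -- Now Y' = P∂_x and G = P_x∂_x. By Jacobi [∂_y, G] = [∂_x, [∂_y, Y']] = 0, and [V, Y'] = vP_x∂_x
  -- does not depend on x, so P_xx = 0. Hence P_x is a constant a.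
  set G := ⁅dx U, Y'⁆ with hG
  have hdyG : ⁅dy U, G⁆ = 0 := by
    rw [hG, leibniz_lie, dy_lie_dx, zero_lie, zero_add, hY', lie_sub, lie_smul, lie_self, smul_zero,
      sub_zero]
    exact hdy.2
  have hVG : ⁅V, Y'⁆ ∈ yFields U := by
    rw [hY', lie_sub, lie_smul]
    exact sub_mem hVY (Submodule.smul_mem _ _ hVdy)
  have hdxG : ⁅dx U, G⁆ = 0 := by
    refine VF.ext_on fun p hp => ?_
    have h1 : (⁅dx U, ⁅V, Y'⁆⁆ : VF U).1 p = 0 := by rw [hVG.2]; rfl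
    have h2 : ∀ r ∈ U, (⁅V, Y'⁆ : VF U).1 r = (V.1 r).1 • G.1 r :=
      fun r hr => lie_apply_of_mem_yFields hV hY'0 hr
    have h3 : HasFDerivAt (fun r => (V.1 r).1 • G.1 r) _ p :=
      (VF.differentiableAt V hp).hasFDerivAt.fst.smul (VF.differentiableAt G hp).hasFDerivAt
    rw [dx_lie_apply _ hp, VF.fderiv_eq h2 hp, h3.fderiv] at h1
    have h4 : (fderiv ℂ V.1 p (1, 0)) = 0 := by rw [← dx_lie_apply V hp, hV.2]; rfl
    rw [dx_lie_apply _ hp]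
    simpa [h4, hV0 p hp] using h1
  obtain ⟨a, ha⟩ := exists_eq_const hU (VF.differentiableOn G)
    (fun p hp => by rw [← dx_lie_apply G hp, hdxG]; rfl)
    (fun p hp => by rw [← dy_lie_apply G hp, hdyG]; rfl)
  refine ⟨a.1, fun p hp => ?_, VF.ext_on fun p hp => ?_⟩
  · rw [VF.coe_sub_apply, VF.coe_smul_apply, xdx_apply hp]
    simp [hY'0 p hp]
  · rw [lie_sub, ← hG, lie_smul, dx_lie_xdx, VF.coe_sub_apply, VF.coe_smul_apply, dx_apply hp,
      ha p hp]
    have : a.2 = 0 := by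
      rw [← ha p hp, hG, dx_lie_apply _ hp]
      exact fderiv_snd_eq_zero hY'0 hp _
    ext <;> simp [this]

/-! ### Algebras containing ∂_y with commutator algebra h -/

lemma mem_sup_of_lie_mem_hSpace (hU : IsPreconnected (U : Set (ℂ × ℂ))) {S : Finset ℂ}
    {n : ℂ → ℕ} {W : VF U} (hW : W ∈ yFields U) (h : ⁅dy U, W⁆ ∈ hSpace U S n) :
    W ∈ hSpace U S n ⊔ ℂ ∙ (expPoly U 0 (X ^ mult S n 0)) := by
  obtain ⟨Z, hZ, hZW⟩ := exists_shear_lie_eq 0 h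
  rw [shear_zero] at hZW
  have hZy : Z ∈ yFields U := (sup_le (hSpace_le_yFields S n)
    ((Submodule.span_singleton_le_iff_mem _ _).2 (expPoly_mem_yFields _ _))) hZ
  obtain ⟨c, hc⟩ := exists_eq_expPoly_C hU (μ := 0) (sub_mem hW hZy)
    (by rw [lie_sub, hZW, sub_self, zero_smul])
  rw [sub_eq_iff_eq_add.1 hc]
  refine add_mem ?_ hZ
  -- The constant of integration lies in V(0) if N > 0, and is a multiple of y^0∂_x if N = 0; the
  -- bound N + 1 covers both cases.
  have h1 : expPoly U 0 (C c) ∈ quasiPoly U 0 (mult S n 0 + 1) :=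
    expPoly_mem_quasiPoly _ (by
      rw [mem_degreeLT]
      exact degree_C_le.trans_lt (by exact_mod_cast Nat.succ_pos _))
  rw [quasiPoly_succ] at h1
  exact sup_le_sup_right (quasiPoly_mult_le S n 0) _ h1

/-- The field is a generalized eigenvector for zero, so lying in h would put it in V(c), where the
degree is below N. -/
lemma expPoly_X_pow_notMem (hU : (U : Set (ℂ × ℂ)).Nonempty) (S : Finset ℂ) (n : ℂ → ℕ) (c : ℂ) :
    expPoly U c (X ^ mult S n c) ∉ hSpace U S n := by
  intro h
  have h1 : expPoly U c (X ^ mult S n c) ∈ quasiPoly U c (mult S n c + 1) :=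
    expPoly_mem_quasiPoly _ (by
      rw [mem_degreeLT, degree_X_pow]; exact_mod_cast Nat.lt_succ_self _)
  have h2 := quasiPoly_le_maxGenEigenspace c c _ h1
  rw [sub_self] at h2
  have h3 : expPoly U c (X ^ mult S n c) ∈ quasiPoly U c (mult S n c) := by
    rw [← hSpace_inf_maxGenEigenspace]; exact ⟨h, h2⟩
  obtain ⟨P, hP, hPX⟩ := h3
  rw [expPoly_injective hU c hPX, SetLike.mem_coe, mem_degreeLT, degree_X_pow] at hP
  exact lt_irrefl _ hP

/-- The algebras between `h + ⟨∂_y⟩` and `h + ⟨∂_y, x ∂_x, y^N ∂_x⟩` with commutator algebra `h`. -/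
lemma eq_of_commutatorAlgebra_eq (hU : (U : Set (ℂ × ℂ)).Nonempty) {S : Finset ℂ} {n : ℂ → ℕ}
    {F : LieSubalgebra ℂ (VF U)} (hdy : dy U ∈ F)
    (hF' : (commutatorAlgebra F).toSubmodule = hSpace U S n)
    (hF : ∀ Y ∈ F, ∃ q a c : ℂ, ∃ W ∈ hSpace U S n,
      Y = q • dy U + a • xdx U + c • expPoly U 0 (X ^ mult S n 0) + W) :
    (¬ ZeroEigenvalueOn (dy U) (hSpace U S n) ∧
      F.toSubmodule = hSpace U S n ⊔ Submodule.span ℂ {dy U}) ∨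
    (F.toSubmodule = hSpace U S n ⊔
      Submodule.span ℂ {dy U, expPoly U 0 (X ^ mult S n 0)}) ∨
    ∃ c : ℂ, F.toSubmodule = hSpace U S n ⊔
      Submodule.span ℂ {dy U, xdx U + c • expPoly U 0 (X ^ mult S n 0)} := by
  set e := expPoly U 0 (X ^ mult S n 0) with he
  have hle : hSpace U S n ≤ F.toSubmodule := hF' ▸ commutatorAlgebra_le F
  have hlie : ∀ V ∈ F, ∀ W ∈ F, ⁅V, W⁆ ∈ hSpace U S n := fun V hV W hW =>
    hF' ▸ lie_mem_commutatorAlgebra hV hW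
  have hY : ∀ Y ∈ F, ∃ q a c : ℂ, ∃ W ∈ hSpace U S n, Y = q • dy U + a • xdx U + c • e + W ∧
      a • xdx U + c • e ∈ F := by
    intro Y hYF
    obtain ⟨q, a, c, W, hW, rfl⟩ := hF Y hYF
    refine ⟨q, a, c, W, hW, rfl, ?_⟩
    have : a • xdx U + c • e = q • dy U + a • xdx U + c • e + W - W - q • dy U := by abel
    rw [this]
    exact sub_mem (sub_mem hYF (hle hW)) (F.smul_mem q hdy)
  -- Modulo h and ∂_y, the algebra is a subspace of ⟨x∂_x, e⟩; the cases are whether it has an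
  -- element with nonzero x∂_x-part and, if not, whether it contains e.
  by_cases h1 : ∃ a c : ℂ, a ≠ 0 ∧ a • xdx U + c • e ∈ F
  · obtain ⟨a, c, ha, hac⟩ := h1
    have hx : xdx U + (a⁻¹ * c) • e ∈ F := by
      have := F.smul_mem a⁻¹ hac
      rwa [smul_add, smul_smul, smul_smul, inv_mul_cancel₀ ha, one_smul] at this
    generalize a⁻¹ * c = c at hx
    right; right
    refine ⟨c, le_antisymm (fun Y hYF => ?_) (sup_le hle ?_)⟩
    · obtain ⟨q, a', c', W, hW, rfl, hac'⟩ := hY Y hYF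
      have h2 : (c' - a' * c) • e ∈ F := by
        have := sub_mem hac' (F.smul_mem a' hx)
        convert! this using 1
        rw [smul_add, smul_smul, sub_smul]; abel
      -- Otherwise e would lie in the algebra, and so would [x∂_x + ce, e] = -e in h, which is
      -- impossible.
      have h3 : c' - a' * c = 0 := by
        by_contra h0
        have h4 : e ∈ F := by
          have := F.smul_mem (c' - a' * c)⁻¹ h2
          rwa [smul_smul, inv_mul_cancel₀ h0, one_smul] at this
        have h5 := hlie _ hx _ h4
        rw [add_lie, smul_lie, lie_self, smul_zero, add_zero, he, xdx_lie_expPoly] at h5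
        exact expPoly_X_pow_notMem hU S n 0 (by simpa using neg_mem h5)
      rw [sub_eq_zero] at h3
      subst h3
      refine add_mem ?_ (Submodule.mem_sup_left hW)
      have : q • dy U + a' • xdx U + (a' * c) • e = q • dy U + a' • (xdx U + c • e) := by
        rw [smul_add, smul_smul]; abel
      rw [this]
      exact Submodule.mem_sup_right (add_mem
        (Submodule.smul_mem _ _ (Submodule.subset_span (Or.inl rfl)))
        (Submodule.smul_mem _ _ (Submodule.subset_span (Or.inr rfl))))
    · rw [Submodule.span_le]
      rintro t (rfl | rfl)
      exacts [hdy, hx]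
  · have ha : ∀ a c : ℂ, a • xdx U + c • e ∈ F → a = 0 := fun a c h => by
      by_contra h0; exact h1 ⟨a, c, h0, h⟩
    by_cases h2 : e ∈ F
    · right; left
      refine le_antisymm (fun Y hYF => ?_) (sup_le hle ?_)
      · obtain ⟨q, a, c, W, hW, rfl, hac⟩ := hY Y hYF
        rw [ha a c hac, zero_smul, add_zero]
        exact add_mem (Submodule.mem_sup_right (add_mem
          (Submodule.smul_mem _ _ (Submodule.subset_span (Or.inl rfl)))
          (Submodule.smul_mem _ _ (Submodule.subset_span (Or.inr rfl)))))
          (Submodule.mem_sup_left hW)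
      · rw [Submodule.span_le]
        rintro t (rfl | rfl)
        exacts [hdy, h2]
    · left
      have hFeq : F.toSubmodule = hSpace U S n ⊔ Submodule.span ℂ {dy U} := by
        refine le_antisymm (fun Y hYF => ?_) (sup_le hle ?_)
        · obtain ⟨q, a, c, W, hW, rfl, hac⟩ := hY Y hYF
          have ha0 := ha a c hac
          rw [ha0, zero_smul, zero_add] at hac
          have hc : c = 0 := by
            by_contra h0
            apply h2
            have := F.smul_mem c⁻¹ hac
            rwa [smul_smul, inv_mul_cancel₀ h0, one_smul] at this
          rw [ha0, hc, zero_smul, zero_smul, add_zero, add_zero]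
          exact add_mem (Submodule.mem_sup_right (Submodule.smul_mem _ _
            (Submodule.subset_span rfl))) (Submodule.mem_sup_left hW)
        · rw [Submodule.span_le]
          rintro t rfl
          exact hdy
      refine ⟨?_, hFeq⟩
      have hD : ∀ V ∈ hSpace U S n, ⁅dy U, V⁆ ∈ hSpace U S n := fun V hV => by
        have := shear_lie_mem_hSpace 0 hV
        rwa [shear_zero] at this
      let T : hSpace U S n →ₗ[ℂ] hSpace U S n :=
        (LieAlgebra.ad ℂ (VF U) (dy U) : VF U →ₗ[ℂ] VF U).restrict hD
      -- In h + ⟨∂_y⟩ every bracket is ∂_y applied to an element of h. These brackets span h, so ∂_y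
      -- is onto, hence injective, on the finite-dimensional h.
      have hT : Function.Surjective T := by
        have hr : hSpace U S n ≤ (LinearMap.range T).map (hSpace U S n).subtype := by
          conv_lhs => rw [← hF', commutatorAlgebra_toSubmodule]
          rw [Submodule.span_le]
          rintro _ ⟨V, hV, W, hW, rfl⟩
          rw [← LieSubalgebra.mem_toSubmodule, hFeq] at hV hW
          obtain ⟨V', hV', _, hq, rfl⟩ := Submodule.mem_sup.1 hV
          obtain ⟨q, rfl⟩ := Submodule.mem_span_singleton.1 hq
          obtain ⟨W', hW', _, hr, rfl⟩ := Submodule.mem_sup.1 hW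
          obtain ⟨r, rfl⟩ := Submodule.mem_span_singleton.1 hr
          refine ⟨T ⟨q • W' - r • V', sub_mem (Submodule.smul_mem _ _ hW')
            (Submodule.smul_mem _ _ hV')⟩, ⟨_, rfl⟩, ?_⟩
          change ⁅dy U, q • W' - r • V'⁆ = _
          rw [add_lie, lie_add, lie_add, hSpace_lie_hSpace hV' hW', lie_smul, smul_lie, smul_lie,
            lie_smul, lie_self, lie_sub, lie_smul, lie_smul, ← lie_skew V' (dy U)]
          simp only [smul_zero, add_zero, zero_add, smul_neg]
          abel
        intro V
        obtain ⟨_, ⟨W, rfl⟩, hW⟩ := hr V.2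
        exact ⟨W, Subtype.ext hW⟩
      rintro ⟨V, hV, hV0, hV'⟩
      have : (⟨V, hV⟩ : hSpace U S n) = 0 :=
        LinearMap.injective_iff_surjective.2 hT (Subtype.ext (by rw [map_zero]; exact hV'))
      exact hV0 (congrArg Subtype.val this)

/-- Classification of the Lie algebras containing `∂_y` whose commutator algebra is abelian,
tangent to the lines `y = const`, and contains some nowhere zero `v(y) ∂_x`. -/
theorem exists_classification (hU : IsPreconnected (U : Set (ℂ × ℂ)))
    (hne : (U : Set (ℂ × ℂ)).Nonempty) {F : LieSubalgebra ℂ (VF U)} (hdy : dy U ∈ F)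
    [FiniteDimensional ℂ (commutatorAlgebra F)]
    (hab : ∀ V ∈ commutatorAlgebra F, ∀ W ∈ commutatorAlgebra F, ⁅V, W⁆ = 0)
    (hsnd : ∀ V ∈ commutatorAlgebra F, ∀ p ∈ U, (V.1 p).2 = 0)
    {V : VF U} (hVF : V ∈ commutatorAlgebra F) (hV : V ∈ yFields U)
    (hV0 : ∀ p ∈ U, (V.1 p).1 ≠ 0) :
    ∃ (S : Finset ℂ) (n : ℂ → ℕ), (∀ μ ∈ S, 0 < n μ) ∧
      (commutatorAlgebra F).toSubmodule = hSpace U S n ∧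
      ((¬ ZeroEigenvalueOn (dy U) (hSpace U S n) ∧
        F.toSubmodule = hSpace U S n ⊔ Submodule.span ℂ {dy U}) ∨
      (F.toSubmodule = hSpace U S n ⊔
        Submodule.span ℂ {dy U, expPoly U 0 (X ^ mult S n 0)}) ∨
      ∃ c : ℂ, F.toSubmodule = hSpace U S n ⊔
        Submodule.span ℂ {dy U, xdx U + c • expPoly U 0 (X ^ mult S n 0)}) := by
  have hA : (commutatorAlgebra F).toSubmodule ≤ yFields U := fun W hW =>
    mem_yFields_of_lie_eq_zero hV hV0 (hsnd W hW) (hab V hVF W hW)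
  have : FiniteDimensional ℂ (commutatorAlgebra F).toSubmodule :=
    inferInstanceAs (FiniteDimensional ℂ (commutatorAlgebra F))
  obtain ⟨S, n, hn, hS⟩ := exists_eq_hSpace hU hA fun W hW =>
    lie_mem_commutatorAlgebra hdy (commutatorAlgebra_le F hW)
  refine ⟨S, n, hn, hS, eq_of_commutatorAlgebra_eq hne hdy hS fun Y hY => ?_⟩
  have hVF' := commutatorAlgebra_le F hVF
  obtain ⟨q, a, hqa⟩ := exists_sub_mem_yFields hU hV hV0 (hA (lie_mem_commutatorAlgebra hVF' hY))
    (hA (lie_mem_commutatorAlgebra hVF' hdy)) (hA (lie_mem_commutatorAlgebra hdy hY))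
  have h1 : ⁅dy U, Y - q • dy U - a • xdx U⁆ ∈ hSpace U S n := by
    rw [lie_sub, lie_sub, lie_smul, lie_smul, lie_self, dy_lie_xdx, smul_zero, smul_zero, sub_zero,
      sub_zero, ← hS]
    exact lie_mem_commutatorAlgebra hdy hY
  obtain ⟨W, hW, Z, hZ, hWZ⟩ := Submodule.mem_sup.1 (mem_sup_of_lie_mem_hSpace hU hqa h1)
  obtain ⟨c, rfl⟩ := Submodule.mem_span_singleton.1 hZ
  refine ⟨q, a, c, W, hW, ?_⟩
  rw [sub_sub, eq_sub_iff_add_eq] at hWZ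
  rw [← hWZ]; abel

/-- The biholomorphic map `(x, y) ↦ (α e^{κ y} x + β, y)` of `ℂ²`, where `α ≠ 0`. -/
def twistHomeo (α κ β : ℂ) (hα : α ≠ 0) : (ℂ × ℂ) ≃ₜ (ℂ × ℂ) where
  toFun p := (α * Complex.exp (κ * p.2) * p.1 + β, p.2)
  invFun q := (α⁻¹ * Complex.exp (-(κ * q.2)) * (q.1 - β), q.2)
  left_inv p := by
    have : Complex.exp (κ * p.2) ≠ 0 := Complex.exp_ne_zero _
    ext
    · simp only [Complex.exp_neg]; field_simp; ring
    · rfl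
  right_inv q := by
    have : Complex.exp (κ * q.2) ≠ 0 := Complex.exp_ne_zero _
    ext
    · simp only [Complex.exp_neg]; field_simp; ring
    · rfl
  continuous_toFun := by fun_prop
  continuous_invFun := by fun_prop

/-! ### The maps (x, y) ↦ (α e^{κy} x + β, y) acting on vector fields -/

section Twist

variable (α κ β : ℂ) (hα : α ≠ 0)

lemma contDiff_twistHomeo : ContDiff ℂ ∞ (twistHomeo α κ β hα) := by
  change ContDiff ℂ ∞ fun p : ℂ × ℂ => (α * Complex.exp (κ * p.2) * p.1 + β, p.2)
  fun_prop

lemma contDiff_twistHomeo_symm : ContDiff ℂ ∞ (twistHomeo α κ β hα).symm := by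
  change ContDiff ℂ ∞ fun q : ℂ × ℂ => (α⁻¹ * Complex.exp (-(κ * q.2)) * (q.1 - β), q.2)
  fun_prop

lemma fderiv_twistHomeo (p v : ℂ × ℂ) : fderiv ℂ (twistHomeo α κ β hα) p v =
    (α * Complex.exp (κ * p.2) * (v.1 + κ * p.1 * v.2), v.2) := by
  have h1 : HasFDerivAt (fun p : ℂ × ℂ => Complex.exp (κ * p.2))
      (Complex.exp (κ * p.2) • (κ • ContinuousLinearMap.snd ℂ ℂ ℂ)) p :=
    (hasFDerivAt_snd.const_mul κ).cexp
  have h2 : HasFDerivAt (fun p : ℂ × ℂ => (α * Complex.exp (κ * p.2) * p.1 + β, p.2)) _ p :=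
    (((h1.const_mul α).mul hasFDerivAt_fst).add_const β).prodMk hasFDerivAt_snd
  change fderiv ℂ (fun p : ℂ × ℂ => (α * Complex.exp (κ * p.2) * p.1 + β, p.2)) p v = _
  rw [h2.fderiv]
  ext
  · simp; ring
  · simp

/-- Composition of local coordinates with `(x, y) ↦ (α e^{κ y} x + β, y)`. -/
def LocalCoordinates.twist (φ : LocalCoordinates U) : LocalCoordinates U where
  toHomeo := φ.toHomeo.transHomeomorph (twistHomeo α κ β hα)
  nonempty_source := φ.nonempty_source
  source_subset := φ.source_subset
  contDiffOn_toFun := (contDiff_twistHomeo α κ β hα).comp_contDiffOn φ.contDiffOn_toFun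
  contDiffOn_symm := φ.contDiffOn_symm.comp (contDiff_twistHomeo_symm α κ β hα).contDiffOn
    fun _ h => h

variable (φ : LocalCoordinates U)

lemma mem_twist_range {q : ℂ × ℂ} :
    q ∈ (φ.twist α κ β hα).range ↔ (twistHomeo α κ β hα).symm q ∈ φ.range := Iff.rfl

lemma contDiffOn_twistPush (W : VF φ.range) : ContDiffOn ℂ ∞
    (fun q => fderiv ℂ (twistHomeo α κ β hα) ((twistHomeo α κ β hα).symm q)
      (W.1 ((twistHomeo α κ β hα).symm q))) (φ.twist α κ β hα).range := by
  have h1 : ContDiff ℂ ∞ (fderiv ℂ (twistHomeo α κ β hα)) :=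
    (contDiff_twistHomeo α κ β hα).fderiv_right (by simp)
  exact (h1.comp (contDiff_twistHomeo_symm α κ β hα)).contDiffOn.clm_apply
    (W.2.1.comp (contDiff_twistHomeo_symm α κ β hα).contDiffOn fun _ h => h)

/-- The action of `(x, y) ↦ (α e^{κ y} x + β, y)` on vector fields. -/
def twistPush : VF φ.range →ₗ[ℂ] VF (φ.twist α κ β hα).range where
  toFun W := VF.mk _ _ (contDiffOn_twistPush α κ β hα φ W)
  map_add' V W := VF.ext_on fun q hq => by
    rw [VF.coe_add_apply, VF.mk_apply _ hq, VF.mk_apply _ hq, VF.mk_apply _ hq, VF.coe_add_apply,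
      map_add]
  map_smul' c V := VF.ext_on fun q hq => by
    rw [RingHom.id_apply, VF.coe_smul_apply, VF.mk_apply _ hq, VF.mk_apply _ hq,
      VF.coe_smul_apply, map_smul]

lemma twistPush_apply (W : VF φ.range) {p : ℂ × ℂ} (hp : p ∈ φ.range) :
    (twistPush α κ β hα φ W).1 (twistHomeo α κ β hα p) =
      (α * Complex.exp (κ * p.2) * ((W.1 p).1 + κ * p.1 * (W.1 p).2), (W.1 p).2) := by
  have hq : twistHomeo α κ β hα p ∈ (φ.twist α κ β hα).range := by
    rw [mem_twist_range, Homeomorph.symm_apply_apply]; exact hp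
  refine (VF.mk_apply (contDiffOn_twistPush α κ β hα φ W) hq).trans ?_
  rw [Homeomorph.symm_apply_apply, fderiv_twistHomeo]

lemma VF.ext_on_twist {V W : VF (φ.twist α κ β hα).range}
    (h : ∀ p ∈ φ.range, V.1 (twistHomeo α κ β hα p) = W.1 (twistHomeo α κ β hα p)) : V = W :=
  VF.ext_on fun q hq => by
    have e := (twistHomeo α κ β hα).apply_symm_apply q
    exact (congrArg V.1 e).symm.trans ((h _ hq).trans (congrArg W.1 e))

lemma twistHomeo_mem_range {p : ℂ × ℂ} (hp : p ∈ φ.range) :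
    twistHomeo α κ β hα p ∈ (φ.twist α κ β hα).range := by
  rw [mem_twist_range, Homeomorph.symm_apply_apply]; exact hp

lemma push_twist (V : VF U) : (φ.twist α κ β hα).push V = twistPush α κ β hα φ (φ.push V) := by
  refine VF.ext_on_twist α κ β hα φ fun p hp => ?_
  rw [twistPush_apply α κ β hα φ _ hp, ← fderiv_twistHomeo α κ β hα]
  refine (VF.mk_apply ((φ.twist α κ β hα).contDiffOn_push V)
    (twistHomeo_mem_range α κ β hα φ hp)).trans ?_
  have h1 : (φ.twist α κ β hα).toHomeo.symm (twistHomeo α κ β hα p) = φ.toHomeo.symm p :=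
    congrArg φ.toHomeo.symm ((twistHomeo α κ β hα).symm_apply_apply p)
  have h2 : (φ.push V).1 p = fderiv ℂ φ.toHomeo (φ.toHomeo.symm p) (V.1 (φ.toHomeo.symm p)) :=
    VF.mk_apply (φ.contDiffOn_push V) hp
  have hs : φ.toHomeo.symm p ∈ φ.toHomeo.source := φ.toHomeo.symm.mapsTo hp
  have h3 : DifferentiableAt ℂ φ.toHomeo (φ.toHomeo.symm p) :=
    (φ.contDiffOn_toFun.contDiffAt (φ.toHomeo.open_source.mem_nhds hs)).differentiableAt (by simp)
  have h4 : φ.toHomeo (φ.toHomeo.symm p) = p := φ.toHomeo.right_inv hp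
  rw [h1, h2]
  change fderiv ℂ (twistHomeo α κ β hα ∘ φ.toHomeo) _ _ = _
  rw [fderiv_comp _ ((contDiff_twistHomeo α κ β hα).differentiable (by simp) _) h3, h4]
  rfl

lemma twistHomeo_fst (p : ℂ × ℂ) :
    (twistHomeo α κ β hα p).1 = α * Complex.exp (κ * p.2) * p.1 + β := rfl

lemma twistHomeo_snd (p : ℂ × ℂ) : (twistHomeo α κ β hα p).2 = p.2 := rfl

lemma twistPush_expPoly (μ : ℂ) (P : ℂ[X]) :
    twistPush α κ β hα φ (expPoly _ μ P) = α • expPoly _ (μ + κ) P := by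
  refine VF.ext_on_twist α κ β hα φ fun p hp => ?_
  rw [twistPush_apply α κ β hα φ _ hp, VF.coe_smul_apply, expPoly_apply _ _ hp,
    expPoly_apply _ _ (twistHomeo_mem_range α κ β hα φ hp), twistHomeo_snd, add_mul,
    Complex.exp_add]
  ext
  · simp; ring
  · simp

lemma twistPush_xdx : twistPush α κ β hα φ (xdx _) = xdx _ - β • dx _ := by
  refine VF.ext_on_twist α κ β hα φ fun p hp => ?_
  have hq := twistHomeo_mem_range α κ β hα φ hp
  rw [twistPush_apply α κ β hα φ _ hp, VF.coe_sub_apply, VF.coe_smul_apply, xdx_apply hp,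
    xdx_apply hq, dx_apply hq, twistHomeo_fst]
  ext <;> simp

lemma twistPush_dy : twistPush α κ β hα φ (dy _) = shear _ κ - (κ * β) • dx _ := by
  refine VF.ext_on_twist α κ β hα φ fun p hp => ?_
  have hq := twistHomeo_mem_range α κ β hα φ hp
  rw [twistPush_apply α κ β hα φ _ hp, VF.coe_sub_apply, VF.coe_smul_apply, shear,
    VF.coe_add_apply, VF.coe_smul_apply, xdx_apply hq, dy_apply hp, dy_apply hq, dx_apply hq,
    twistHomeo_fst]
  ext
  · simp; ring
  · simp

/-- The exponents of `h` after multiplication by `e^{κ y}`. -/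
def shiftFinset (S : Finset ℂ) : Finset ℂ := S.map (addRightEmbedding κ)

lemma mem_shiftFinset {S : Finset ℂ} {μ : ℂ} : μ ∈ shiftFinset κ S ↔ μ - κ ∈ S := by
  simp [shiftFinset, ← eq_sub_iff_add_eq]

lemma mult_shiftFinset (S : Finset ℂ) (n : ℂ → ℕ) :
    mult (shiftFinset κ S) (fun μ => n (μ - κ)) κ = mult S n 0 := by
  by_cases h : (0 : ℂ) ∈ S
  · rw [mult_of_mem h, mult_of_mem (by rwa [mem_shiftFinset, sub_self]), sub_self]
  · rw [mult_of_notMem h, mult_of_notMem (by rwa [mem_shiftFinset, sub_self])]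

lemma map_twistPush_hSpace (S : Finset ℂ) (n : ℂ → ℕ) :
    (hSpace _ S n).map (twistPush α κ β hα φ) =
      hSpace _ (shiftFinset κ S) (fun μ => n (μ - κ)) := by
  have h : ∀ μ m, (quasiPoly φ.range μ m).map (twistPush α κ β hα φ) =
      quasiPoly _ (μ + κ) m := by
    intro μ m
    rw [quasiPoly, ← Submodule.map_comp]
    have : twistPush α κ β hα φ ∘ₗ expPoly _ μ = α • expPoly _ (μ + κ) :=
      LinearMap.ext fun P => twistPush_expPoly α κ β hα φ μ P
    rw [this, Submodule.map_smul _ _ _ hα]; rfl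
  simp_rw [hSpace, Submodule.map_iSup, h]
  apply le_antisymm
  · refine iSup₂_le fun μ hμ => ?_
    refine le_iSup₂_of_le (μ + κ) (mem_shiftFinset κ |>.2 (by simpa using hμ)) ?_
    simp
  · refine iSup₂_le fun μ hμ => ?_
    refine le_iSup₂_of_le (μ - κ) (mem_shiftFinset κ |>.1 hμ) ?_
    simp

end Twist

lemma map_push_twist {α κ β : ℂ} (hα : α ≠ 0) (φ : LocalCoordinates U)
    (F : Submodule ℂ (VF U)) : F.map (φ.twist α κ β hα).push =
      (F.map φ.push).map (twistPush α κ β hα φ) := by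
  rw [← Submodule.map_comp]
  congr 1
  exact LinearMap.ext fun V => push_twist α κ β hα φ V

lemma LocalCoordinates.range_nonempty (φ : LocalCoordinates U) :
    (φ.range : Set (ℂ × ℂ)).Nonempty := by
  obtain ⟨p, hp⟩ := φ.nonempty_source
  exact ⟨_, φ.toHomeo.mapsTo hp⟩

/-- The remaining change of coordinates: an algebra `h + ⟨∂_y, x ∂_x + c y^N ∂_x⟩` is brought to a
normal form. -/
lemma exists_isNormalForm_of_eq (φ : LocalCoordinates U) {F F' : Submodule ℂ (VF U)}
    {S : Finset ℂ} {n : ℂ → ℕ} (hn : ∀ μ ∈ S, 0 < n μ) {c : ℂ}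
    (hF' : F'.map φ.push = hSpace φ.range S n)
    (hF : F.map φ.push = hSpace φ.range S n ⊔
      Submodule.span ℂ {dy _, xdx _ + c • expPoly _ 0 (X ^ mult S n 0)}) :
    ∃ ψ : LocalCoordinates U, ψ.toHomeo.source = φ.toHomeo.source ∧
      ∃ (S : Finset ℂ) (n : ℂ → ℕ), (∀ μ ∈ S, 0 < n μ) ∧
        IsNormalForm S n (F.map ψ.push) ∧ F'.map ψ.push = hSpace ψ.range S n := by
  by_cases hc : c = 0
  · refine ⟨φ, rfl, S, n, hn, ?_, hF'⟩
    rw [isNormalForm_iff φ.range_nonempty, hF, hc]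
    right; left
    simp [shear_zero]
  by_cases hN : mult S n 0 = 0
  · refine ⟨φ.twist 1 0 c one_ne_zero, rfl, shiftFinset 0 S, fun μ => n (μ - 0),
      fun μ hμ => hn _ ((mem_shiftFinset 0).1 hμ), ?_, ?_⟩
    · rw [isNormalForm_iff (LocalCoordinates.range_nonempty _), map_push_twist, hF,
        Submodule.map_sup, map_twistPush_hSpace, Submodule.map_span, Set.image_pair, map_add,
        map_smul, twistPush_dy, twistPush_xdx, twistPush_expPoly, hN]
      right; left
      simp [dx]
    · rw [map_push_twist, hF', map_twistPush_hSpace]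
  -- The factor c⁻¹ scales c y^N∂_x to coefficient 1, while e^y shifts all exponents by 1 and turns
  -- ∂_y into x∂_x + ∂_y.
  · refine ⟨φ.twist c⁻¹ 1 0 (inv_ne_zero hc), rfl, shiftFinset 1 S, fun μ => n (μ - 1),
      fun μ hμ => hn _ ((mem_shiftFinset 1).1 hμ), ?_, ?_⟩
    · rw [isNormalForm_iff (LocalCoordinates.range_nonempty _), map_push_twist, hF,
        Submodule.map_sup, map_twistPush_hSpace, Submodule.map_span, Set.image_pair, map_add,
        map_smul, twistPush_dy, twistPush_xdx, twistPush_expPoly, mult_shiftFinset]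
      right; right; right; right; right
      refine ⟨Nat.pos_of_ne_zero hN, ?_⟩
      simp [smul_smul, mul_inv_cancel₀ hc]
    · rw [map_push_twist, hF', map_twistPush_hSpace]

/-! Vector fields in local coordinates. -/

section Push

variable (φ : LocalCoordinates U)

lemma LocalCoordinates.push_apply (V : VF U) {q : ℂ × ℂ} (hq : q ∈ φ.range) :
    (φ.push V).1 q = fderiv ℂ φ.toHomeo (φ.toHomeo.symm q) (V.1 (φ.toHomeo.symm q)) :=
  VF.mk_apply (φ.contDiffOn_push V) hq

lemma LocalCoordinates.contDiffAt_symm {q : ℂ × ℂ} (hq : q ∈ φ.range) :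
    ContDiffAt ℂ ∞ φ.toHomeo.symm q :=
  φ.contDiffOn_symm.contDiffAt (φ.toHomeo.open_target.mem_nhds hq)

lemma LocalCoordinates.symm_mem {q : ℂ × ℂ} (hq : q ∈ φ.range) : φ.toHomeo.symm q ∈ U :=
  φ.source_subset (φ.toHomeo.symm.mapsTo hq)

lemma LocalCoordinates.inverse_fderiv_symm {q : ℂ × ℂ} (hq : q ∈ φ.range) :
    (fderiv ℂ φ.toHomeo.symm q).inverse = fderiv ℂ φ.toHomeo (φ.toHomeo.symm q) := by
  have hs : φ.toHomeo.symm q ∈ φ.toHomeo.source := φ.toHomeo.symm.mapsTo hq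
  have h1 : HasFDerivAt φ.toHomeo.symm (fderiv ℂ φ.toHomeo.symm q) q :=
    ((φ.contDiffAt_symm hq).differentiableAt (by simp)).hasFDerivAt
  have h2 : HasFDerivAt φ.toHomeo (fderiv ℂ φ.toHomeo (φ.toHomeo.symm q)) (φ.toHomeo.symm q) :=
    ((φ.contDiffOn_toFun.contDiffAt (φ.toHomeo.open_source.mem_nhds hs)).differentiableAt
      (by simp)).hasFDerivAt
  apply ContinuousLinearMap.inverse_eq
  · have h1' : HasFDerivAt φ.toHomeo.symm (fderiv ℂ φ.toHomeo.symm q)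
        (φ.toHomeo (φ.toHomeo.symm q)) := by rw [φ.toHomeo.right_inv hq]; exact h1
    have h3 := h1'.comp _ h2
    refine h3.unique ((hasFDerivAt_id _).congr_of_eventuallyEq ?_)
    filter_upwards [φ.toHomeo.open_source.mem_nhds hs] with r hr using φ.toHomeo.left_inv hr
  · have h3 := h2.comp _ h1
    refine h3.unique ((hasFDerivAt_id _).congr_of_eventuallyEq ?_)
    filter_upwards [φ.toHomeo.open_target.mem_nhds hq] with r hr using φ.toHomeo.right_inv hr

/-- Pushing forward by a chart is pulling back by its inverse, so naturality of the Lie bracket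
under pullback applies. -/
lemma LocalCoordinates.push_eq_pullback (V : VF U) {q : ℂ × ℂ} (hq : q ∈ φ.range) :
    (φ.push V).1 q = VectorField.pullback ℂ φ.toHomeo.symm V.1 q := by
  rw [φ.push_apply V hq, VectorField.pullback, φ.inverse_fderiv_symm hq]

lemma LocalCoordinates.push_lie (V W : VF U) : φ.push ⁅V, W⁆ = ⁅φ.push V, φ.push W⁆ := by
  refine VF.ext_on fun q hq => ?_
  have h : ∀ V : VF U, (φ.push V).1 =ᶠ[nhds q] VectorField.pullback ℂ φ.toHomeo.symm V.1 :=
    fun V => Filter.eventuallyEq_of_mem (φ.toHomeo.open_target.mem_nhds hq)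
      fun r hr => φ.push_eq_pullback V hr
  rw [VF.bracket_apply _ _ hq, Filter.EventuallyEq.lieBracket_vectorField_eq (h V) (h W),
    ← VectorField.pullback_lieBracket (n := ∞)
      (by rw [minSmoothness_of_isRCLikeNormedField]; exact WithTop.coe_le_coe.2 le_top)
      (φ.contDiffAt_symm hq) (VF.differentiableAt V (φ.symm_mem hq))
      (VF.differentiableAt W (φ.symm_mem hq)),
    φ.push_eq_pullback _ hq, VectorField.pullback, VectorField.pullback,
    VF.bracket_apply _ _ (φ.symm_mem hq)]

/-- The expression of vector fields in local coordinates, as a homomorphism of Lie algebras. -/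
def LocalCoordinates.pushHom : VF U →ₗ⁅ℂ⁆ VF φ.range :=
  { φ.push with map_lie' := fun {V W} => φ.push_lie V W }

lemma commutatorAlgebra_map_pushHom (g : LieSubalgebra ℂ (VF U)) :
    (commutatorAlgebra (g.map φ.pushHom)).toSubmodule =
      (commutatorAlgebra g).toSubmodule.map φ.push := by
  rw [commutatorAlgebra_toSubmodule, commutatorAlgebra_toSubmodule, Submodule.map_span]
  congr 1
  ext Z
  constructor
  · rintro ⟨_, ⟨V, hV, rfl⟩, _, ⟨W, hW, rfl⟩, rfl⟩
    exact ⟨_, ⟨V, hV, W, hW, rfl⟩, φ.push_lie V W⟩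
  · rintro ⟨_, ⟨V, hV, W, hW, rfl⟩, rfl⟩
    exact ⟨_, ⟨V, hV, rfl⟩, _, ⟨W, hW, rfl⟩, (φ.push_lie V W).symm⟩

end Push

/-! Closed 1-forms. -/

/-- Cartan's formula for the exterior derivative of a 1-form. -/
lemma fderiv_form_sub {σ : ℂ × ℂ → ℂ × ℂ →L[ℂ] ℂ} {A B : ℂ × ℂ → ℂ × ℂ} {q : ℂ × ℂ}
    (hσ : DifferentiableAt ℂ σ q) (hA : DifferentiableAt ℂ A q) (hB : DifferentiableAt ℂ B q) :
    fderiv ℂ σ q (A q) (B q) - fderiv ℂ σ q (B q) (A q) =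
      fderiv ℂ (fun r => σ r (B r)) q (A q) - fderiv ℂ (fun r => σ r (A r)) q (B q) -
        σ q (VectorField.lieBracket ℂ A B q) := by
  rw [(hσ.hasFDerivAt.clm_apply hA.hasFDerivAt).fderiv,
    (hσ.hasFDerivAt.clm_apply hB.hasFDerivAt).fderiv, VectorField.lieBracket]
  simp only [add_apply, ContinuousLinearMap.comp_apply,
    ContinuousLinearMap.flip_apply, map_sub]
  ring

/-- The determinant of two vectors of the plane. -/
def planeDet (v w : ℂ × ℂ) : ℂ := v.1 * w.2 - v.2 * w.1

lemma eq_combination_of_planeDet_ne_zero {v w : ℂ × ℂ} (h : planeDet v w ≠ 0) (u : ℂ × ℂ) :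
    u = (planeDet u w / planeDet v w) • v + (planeDet v u / planeDet v w) • w := by
  ext
  · rw [Prod.fst_add, Prod.smul_fst, Prod.smul_fst, smul_eq_mul, smul_eq_mul, div_mul_eq_mul_div,
      div_mul_eq_mul_div, ← add_div, eq_div_iff h]
    simp only [planeDet]; ring
  · rw [Prod.snd_add, Prod.smul_snd, Prod.smul_snd, smul_eq_mul, smul_eq_mul, div_mul_eq_mul_div,
      div_mul_eq_mul_div, ← add_div, eq_div_iff h]
    simp only [planeDet]; ring

/-- Symmetry of a bilinear form on the plane can be tested on a basis. -/
lemma bilin_symm_of_planeDet_ne_zero {v w : ℂ × ℂ} (h : planeDet v w ≠ 0)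
    {T : ℂ × ℂ →L[ℂ] ℂ × ℂ →L[ℂ] ℂ} (hT : T v w = T w v) (a b : ℂ × ℂ) : T a b = T b a := by
  rw [eq_combination_of_planeDet_ne_zero h a, eq_combination_of_planeDet_ne_zero h b]
  simp only [map_add, map_smul, add_apply, smul_apply,
    smul_eq_mul, hT]
  ring

/-- The Poincaré lemma for smooth complex 1-forms in the plane, where closedness is tested on a
frame. -/
lemma exists_primitive {B : Set (ℂ × ℂ)} (hB : Convex ℝ B) (hBo : IsOpen B)
    {σ : ℂ × ℂ → ℂ × ℂ →L[ℂ] ℂ} (hσ : ContDiffOn ℂ ∞ σ B) {V X : ℂ × ℂ → ℂ × ℂ}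
    (hVX : ∀ q ∈ B, planeDet (V q) (X q) ≠ 0)
    (hd : ∀ q ∈ B, fderiv ℂ σ q (V q) (X q) = fderiv ℂ σ q (X q) (V q)) :
    ∃ f : ℂ × ℂ → ℂ, ContDiffOn ℂ ∞ f B ∧ ∀ q ∈ B, HasFDerivAt f (σ q) q := by
  have hdiff : ∀ q ∈ B, DifferentiableAt ℂ σ q := fun q hq =>
    (hσ.contDiffAt (hBo.mem_nhds hq)).differentiableAt (by simp)
  obtain ⟨f, hf⟩ := hB.exists_forall_hasFDerivAt_of_fderiv_symmetric hBo
    (fun q hq => ((hdiff q hq).restrictScalars ℝ).differentiableWithinAt) (fun q hq a b => by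
      rw [(hdiff q hq).fderiv_restrictScalars ℝ]
      exact bilin_symm_of_planeDet_ne_zero (hVX q hq) (hd q hq) a b)
  refine ⟨f, ?_, hf⟩
  rw [contDiffOn_infty_iff_fderiv_of_isOpen hBo]
  exact ⟨fun q hq => (hf q hq).differentiableAt.differentiableWithinAt,
    hσ.congr fun q hq => (hf q hq).fderiv⟩

lemma fderiv_congr_on {E F : Type*} [NormedAddCommGroup E] [NormedSpace ℂ E]
    [NormedAddCommGroup F] [NormedSpace ℂ F] {f g : E → F} {B : Set E} (hB : IsOpen B)
    (h : ∀ q ∈ B, f q = g q) {q : E} (hq : q ∈ B) : fderiv ℂ f q = fderiv ℂ g q :=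
  Filter.EventuallyEq.fderiv_eq (Filter.eventuallyEq_of_mem (hB.mem_nhds hq) h)

/-- Two independent fields `V`, `X` with `[X, V] = f V` and `V f = 0` are, in suitable
coordinates, `e^{-m} ∂_x` and `∂_y`. -/
lemma exists_coordinate_functions {B : Set (ℂ × ℂ)} (hB : Convex ℝ B) (hBo : IsOpen B)
    {V X : ℂ × ℂ → ℂ × ℂ} (hV : ContDiffOn ℂ ∞ V B) (hX : ContDiffOn ℂ ∞ X B)
    (hVX : ∀ q ∈ B, planeDet (V q) (X q) ≠ 0) {Z : ℂ × ℂ → ℂ × ℂ} (hZ : ContDiffOn ℂ ∞ Z B)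
    (hZX : ∀ q ∈ B, Z q = VectorField.lieBracket ℂ X V q)
    (hZV : ∀ q ∈ B, ∃ c : ℂ, Z q = c • V q)
    (hcomm : ∀ q ∈ B, VectorField.lieBracket ℂ V Z q = 0) :
    ∃ (x y m : ℂ × ℂ → ℂ) (dx dy dm : ℂ × ℂ → ℂ × ℂ →L[ℂ] ℂ),
      ContDiffOn ℂ ∞ x B ∧ ContDiffOn ℂ ∞ y B ∧
      (∀ q ∈ B, HasFDerivAt x (dx q) q ∧ HasFDerivAt y (dy q) q ∧ HasFDerivAt m (dm q) q) ∧
      (∀ q ∈ B, dx q (V q) = Complex.exp (-m q) ∧ dx q (X q) = 0 ∧ dy q (V q) = 0 ∧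
        dy q (X q) = 1 ∧ dm q (V q) = 0) := by
  have dV : ∀ q ∈ B, DifferentiableAt ℂ V q := fun q hq =>
    (hV.contDiffAt (hBo.mem_nhds hq)).differentiableAt (by simp)
  have dX : ∀ q ∈ B, DifferentiableAt ℂ X q := fun q hq =>
    (hX.contDiffAt (hBo.mem_nhds hq)).differentiableAt (by simp)
  have dZ : ∀ q ∈ B, DifferentiableAt ℂ Z q := fun q hq =>
    (hZ.contDiffAt (hBo.mem_nhds hq)).differentiableAt (by simp)
  have diff : ∀ {σ : ℂ × ℂ → ℂ × ℂ →L[ℂ] ℂ}, ContDiffOn ℂ ∞ σ B →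
      ∀ q ∈ B, DifferentiableAt ℂ σ q := fun hσ q hq =>
    (hσ.contDiffAt (hBo.mem_nhds hq)).differentiableAt (by simp)
  have hΔ : ContDiffOn ℂ ∞ (fun q => (planeDet (V q) (X q))⁻¹) B := by
    refine ContDiffOn.inv ?_ hVX
    exact (hV.fst.mul hX.snd).sub (hV.snd.mul hX.fst)
  -- The forms ω₁ and ω₂ are the coframe dual to (V, X), written by Cramer's rule.
  let ω₁ : ℂ × ℂ → ℂ × ℂ →L[ℂ] ℂ := fun q => (planeDet (V q) (X q))⁻¹ •
    ((X q).2 • ContinuousLinearMap.fst ℂ ℂ ℂ - (X q).1 • ContinuousLinearMap.snd ℂ ℂ ℂ)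
  let ω₂ : ℂ × ℂ → ℂ × ℂ →L[ℂ] ℂ := fun q => (planeDet (V q) (X q))⁻¹ •
    ((V q).1 • ContinuousLinearMap.snd ℂ ℂ ℂ - (V q).2 • ContinuousLinearMap.fst ℂ ℂ ℂ)
  have hω₁ : ContDiffOn ℂ ∞ ω₁ B := hΔ.smul ((hX.snd.smul contDiffOn_const).sub
    (hX.fst.smul contDiffOn_const))
  have hω₂ : ContDiffOn ℂ ∞ ω₂ B := hΔ.smul ((hV.fst.smul contDiffOn_const).sub
    (hV.snd.smul contDiffOn_const))
  have e₁ : ∀ q v, ω₁ q v = (planeDet (V q) (X q))⁻¹ * planeDet v (X q) := fun q v => by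
    change _ * ((X q).2 * v.1 - (X q).1 * v.2) = _ * (v.1 * (X q).2 - v.2 * (X q).1)
    ring
  have e₂ : ∀ q v, ω₂ q v = (planeDet (V q) (X q))⁻¹ * planeDet (V q) v := fun q v => rfl
  have hself : ∀ v, planeDet v v = 0 := fun v => by simp only [planeDet]; ring
  have h1V : ∀ q ∈ B, ω₁ q (V q) = 1 := fun q hq => by rw [e₁, inv_mul_cancel₀ (hVX q hq)]
  have h1X : ∀ q ∈ B, ω₁ q (X q) = 0 := fun q _ => by rw [e₁, hself, mul_zero]
  have h2V : ∀ q ∈ B, ω₂ q (V q) = 0 := fun q _ => by rw [e₂, hself, mul_zero]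
  have h2X : ∀ q ∈ B, ω₂ q (X q) = 1 := fun q hq => by rw [e₂, inv_mul_cancel₀ (hVX q hq)]
  let f : ℂ × ℂ → ℂ := fun q => ω₁ q (Z q)
  have hf : ContDiffOn ℂ ∞ f B := hω₁.clm_apply hZ
  have hZf : ∀ q ∈ B, Z q = f q • V q := fun q hq => by
    obtain ⟨c, hc⟩ := hZV q hq
    have : f q = c := by
      change ω₁ q (Z q) = c
      rw [hc, map_smul, h1V q hq, smul_eq_mul, mul_one]
    rw [this, hc]
  have hXV : ∀ q ∈ B, VectorField.lieBracket ℂ V X q = -(f q • V q) := fun q hq => by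
    rw [VectorField.lieBracket_swap, ← hZX q hq, hZf q hq]
  -- Cartan's formula for ω₁ on V and Z = fV: dω₁(V, fV) = 0, ω₁(V) = 1 and [V, Z] = 0 leave Vf = 0.
  have hVf : ∀ q ∈ B, fderiv ℂ f q (V q) = 0 := by
    intro q hq
    have h := fderiv_form_sub (diff hω₁ q hq) (dV q hq) (dZ q hq)
    rw [hcomm q hq, map_zero, sub_zero, fderiv_congr_on hBo h1V hq, hZf q hq] at h
    simp only [map_smul, smul_apply, sub_self, fderiv_fun_const, Pi.zero_apply,
      zero_apply, smul_zero, sub_zero] at h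
    exact h.symm
  obtain ⟨y, hy, hdy⟩ := exists_primitive hB hBo hω₂ hVX fun q hq => by
    have h := fderiv_form_sub (diff hω₂ q hq) (dV q hq) (dX q hq)
    rw [fderiv_congr_on hBo h2V hq, fderiv_congr_on hBo h2X hq, hXV q hq, map_neg, map_smul,
      h2V q hq] at h
    simpa [sub_eq_zero] using h
  -- Since dη(V, X) = -Vf = 0, there is m with Vm = 0 and Xm = -f. Then e^{-m} is an integrating
  -- factor for ω₁: d(e^{-m}ω₁)(V, X) = e^{-m}(Xm + f) = 0.
  let η : ℂ × ℂ → ℂ × ℂ →L[ℂ] ℂ := fun q => (-f q) • ω₂ q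
  have hη : ContDiffOn ℂ ∞ η B := hf.neg.smul hω₂
  have hηV : ∀ q ∈ B, η q (V q) = 0 := fun q hq => by simp [η, h2V q hq]
  have hηX : ∀ q ∈ B, η q (X q) = -f q := fun q hq => by simp [η, h2X q hq]
  obtain ⟨m, hm, hdm⟩ := exists_primitive hB hBo hη hVX fun q hq => by
    have h := fderiv_form_sub (diff hη q hq) (dV q hq) (dX q hq)
    rw [fderiv_congr_on hBo hηV hq, fderiv_congr_on hBo hηX hq, hXV q hq, map_neg, map_smul,
      hηV q hq] at h
    simpa [sub_eq_zero, hVf q hq] using h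
  let θ : ℂ × ℂ → ℂ × ℂ →L[ℂ] ℂ := fun q => Complex.exp (-m q) • ω₁ q
  have hθ : ContDiffOn ℂ ∞ θ B := hm.neg.cexp.smul hω₁
  have hθV : ∀ q ∈ B, θ q (V q) = Complex.exp (-m q) := fun q hq => by simp [θ, h1V q hq]
  have hexp : ∀ q ∈ B, HasFDerivAt (fun q => Complex.exp (-m q)) (Complex.exp (-m q) • -η q) q :=
    fun q hq => ((hdm q hq).neg).cexp
  have hθX : ∀ q ∈ B, θ q (X q) = 0 := fun q hq => by simp [θ, h1X q hq]
  obtain ⟨x, hx, hdx⟩ := exists_primitive hB hBo hθ hVX fun q hq => by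
    have h := fderiv_form_sub (diff hθ q hq) (dV q hq) (dX q hq)
    rw [fderiv_congr_on hBo hθV hq, fderiv_congr_on hBo hθX hq, hXV q hq, map_neg, map_smul,
      hθV q hq, (hexp q hq).fderiv] at h
    simp only [fderiv_fun_const, Pi.zero_apply, zero_apply,
      smul_apply, neg_apply, hηX q hq, smul_eq_mul] at h
    rw [← sub_eq_zero, h]; ring
  exact ⟨x, y, m, θ, ω₂, η, hx, hy, fun q hq => ⟨hdx q hq, hdy q hq, hdm q hq⟩,
    fun q hq => ⟨hθV q hq, hθX q hq, h2V q hq, h2X q hq, hηV q hq⟩⟩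

/-- The inverse function theorem as a construction of local coordinates with connected range. -/
lemma exists_localCoordinates {B : Set (ℂ × ℂ)} (hBo : IsOpen B) (hBU : B ⊆ U) {p : ℂ × ℂ}
    (hp : p ∈ B) {f : ℂ × ℂ → ℂ × ℂ} (hf : ContDiffOn ℂ ∞ f B)
    {f' : ℂ × ℂ → (ℂ × ℂ) ≃L[ℂ] (ℂ × ℂ)}
    (hf' : ∀ q ∈ B, HasFDerivAt f (f' q : ℂ × ℂ →L[ℂ] ℂ × ℂ) q) :
    ∃ φ : LocalCoordinates U, φ.toHomeo.source ⊆ B ∧ ⇑φ.toHomeo = f ∧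
      IsPreconnected (φ.range : Set (ℂ × ℂ)) := by
  have hc : ContDiffAt ℂ ∞ f p := hf.contDiffAt (hBo.mem_nhds hp)
  have h0 : (∞ : WithTop ℕ∞) ≠ 0 := by simp
  let e := hc.toOpenPartialHomeomorph f (hf' p hp) h0
  have hpe : p ∈ e.source := hc.mem_toOpenPartialHomeomorph_source (hf' p hp) h0
  let e₁ := e.restrOpen B hBo
  have hp1 : p ∈ e₁.source := ⟨hpe, hp⟩
  obtain ⟨r, hr, hrB⟩ := Metric.isOpen_iff.1 e₁.open_target (e₁ p) (e₁.mapsTo hp1)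
  -- Shrinking on the target side, to a ball, makes the range of the chart connected.
  let e₂ := (e₁.symm.restrOpen (Metric.ball (e₁ p) r) Metric.isOpen_ball).symm
  have hsource : e₂.source ⊆ B := fun q hq => by
    have : q ∈ e₁.source := e₁.symm.mapsTo (e₂.mapsTo hq).1 |> fun h => by
      have h2 := e₂.left_inv hq
      change e₁.symm (e₂ q) = q at h2
      rw [h2] at h; exact h
    exact this.2
  have htarget : e₂.target = Metric.ball (e₁ p) r :=
    Set.inter_eq_right.2 hrB
  refine ⟨⟨e₂, ⟨e₁.symm (e₁ p), e₂.symm.mapsTo (by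
      change e₁ p ∈ e₂.target
      rw [htarget]; exact Metric.mem_ball_self hr)⟩, hsource.trans hBU, hf.mono hsource, ?_⟩,
    hsource, rfl, ?_⟩
  · intro q hq
    have hqB : e₂.symm q ∈ B := hsource (e₂.symm.mapsTo hq)
    exact (e₂.contDiffAt_symm hq (hf' _ hqB) (hf.contDiffAt (hBo.mem_nhds hqB))).contDiffWithinAt
  · change IsPreconnected e₂.target
    rw [htarget]
    exact (convex_ball _ _).isPreconnected

/-- Two linear forms that are triangular on a basis are coordinates. -/
def frameEquiv (α β : ℂ × ℂ →L[ℂ] ℂ) (v w : ℂ × ℂ) (hvw : planeDet v w ≠ 0) (c : ℂ) (hc : c ≠ 0)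
    (h1 : α v = c) (h2 : α w = 0) (h3 : β v = 0) (h4 : β w = 1) : (ℂ × ℂ) ≃L[ℂ] (ℂ × ℂ) :=
  ContinuousLinearEquiv.equivOfInverse (α.prod β)
    ((ContinuousLinearMap.fst ℂ ℂ ℂ).smulRight (c⁻¹ • v) +
      (ContinuousLinearMap.snd ℂ ℂ ℂ).smulRight w)
    (fun u => by
      rw [eq_combination_of_planeDet_ne_zero hvw u]
      simp [h1, h2, h3, h4, smul_smul, hc])
    (fun u => by
      ext <;> simp [h1, h2, h3, h4, hc])

lemma frameEquiv_symm_apply (α β : ℂ × ℂ →L[ℂ] ℂ) (v w : ℂ × ℂ) (hvw : planeDet v w ≠ 0) (c : ℂ)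
    (hc : c ≠ 0) (h1 : α v = c) (h2 : α w = 0) (h3 : β v = 0) (h4 : β w = 1) (u : ℂ × ℂ) :
    (frameEquiv α β v w hvw c hc h1 h2 h3 h4).symm u = u.1 • (c⁻¹ • v) + u.2 • w := rfl

/-- The coordinates x, y have differentials e^{-m}ω₁ and ω₂ for the coframe (ω₁, ω₂) dual to (V, X),
so X becomes ∂_y and V becomes e^{-m}∂_x; as Vm = 0, the coefficient depends on y only. -/
lemma exists_adapted_coordinates {N : Opens (ℂ × ℂ)} (hNU : N ≤ U) {p : ℂ × ℂ} (hp : p ∈ N)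
    {V X : VF U} (hVX : planeDet (V.1 p) (X.1 p) ≠ 0)
    (hXV : ∀ q ∈ N, V.1 q ≠ 0 → ∃ c : ℂ, (⁅X, V⁆ : VF U).1 q = c • V.1 q)
    (hcomm : ⁅V, ⁅X, V⁆⁆ = 0) :
    ∃ φ : LocalCoordinates U, φ.toHomeo.source ⊆ N ∧ IsPreconnected (φ.range : Set (ℂ × ℂ)) ∧
      φ.push X = dy φ.range ∧ φ.push V ∈ yFields φ.range ∧
      ∀ q ∈ φ.range, ((φ.push V).1 q).1 ≠ 0 := by
  have hcont : ContinuousOn (fun q => planeDet (V.1 q) (X.1 q)) N := by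
    have h1 := V.2.1.continuousOn.mono hNU
    have h2 := X.2.1.continuousOn.mono hNU
    exact (h1.fst.mul h2.snd).sub (h1.snd.mul h2.fst)
  obtain ⟨r, hr, hB⟩ := Metric.isOpen_iff.1
    (hcont.isOpen_inter_preimage N.isOpen isOpen_compl_singleton) p ⟨hp, hVX⟩
  set B := Metric.ball p r with hBdef
  have hBN : B ⊆ N := fun q hq => (hB hq).1
  have hBU : B ⊆ U := fun q hq => hNU (hBN hq)
  have hdet : ∀ q ∈ B, planeDet (V.1 q) (X.1 q) ≠ 0 := fun q hq => (hB hq).2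
  have hBo : IsOpen B := Metric.isOpen_ball
  obtain ⟨x, y, m, x', y', m', hx, hy, hd, hframe⟩ := exists_coordinate_functions
    (convex_ball p r) hBo (V.2.1.mono hBU) (X.2.1.mono hBU) hdet
    (Z := (⁅X, V⁆ : VF U).1) ((⁅X, V⁆ : VF U).2.1.mono hBU)
    (fun q hq => VF.bracket_apply _ _ (hBU hq))
    (fun q hq => hXV q (hBN hq) fun h0 => hdet q hq (by simp [planeDet, h0]))
    (fun q hq => by rw [← VF.bracket_apply _ _ (hBU hq), hcomm]; rfl)
  have hex : ∀ q : ℂ × ℂ, ∃ E : (ℂ × ℂ) ≃L[ℂ] (ℂ × ℂ), q ∈ B →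
      (E : ℂ × ℂ →L[ℂ] ℂ × ℂ) = (x' q).prod (y' q) ∧
      E.symm (1, 0) = (Complex.exp (-m q))⁻¹ • V.1 q := by
    intro q
    by_cases hq : q ∈ B
    -- The inverse differential sends ∂_x to e^m V; this is what later turns Vm = 0 into
    -- independence of x.
    · obtain ⟨h1, h2, h3, h4, -⟩ := hframe q hq
      refine ⟨frameEquiv _ _ _ _ (hdet q hq) _ (Complex.exp_ne_zero _) h1 h2 h3 h4, fun _ =>
        ⟨rfl, ?_⟩⟩
      rw [frameEquiv_symm_apply]; simp
    · exact ⟨ContinuousLinearEquiv.refl ℂ _, fun h => absurd h hq⟩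
  choose E hE hE' using hex
  have hEd : ∀ q ∈ B, HasFDerivAt (fun q => (x q, y q)) (E q : ℂ × ℂ →L[ℂ] ℂ × ℂ) q :=
    fun q hq => by rw [hE q hq]; exact (hd q hq).1.prodMk (hd q hq).2.1
  obtain ⟨φ, hφB, hφ, hconn⟩ := exists_localCoordinates hBo hBU (Metric.mem_ball_self hr)
    (hx.prodMk hy) hEd
  have hmem : ∀ q ∈ φ.range, φ.toHomeo.symm q ∈ B := fun q hq => hφB (φ.toHomeo.symm.mapsTo hq)
  have hpush : ∀ (W : VF U), ∀ q ∈ φ.range, (φ.push W).1 q =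
      (x' (φ.toHomeo.symm q) (W.1 (φ.toHomeo.symm q)),
        y' (φ.toHomeo.symm q) (W.1 (φ.toHomeo.symm q))) := by
    intro W q hq
    rw [φ.push_apply W hq, hφ, (hEd _ (hmem q hq)).fderiv, hE _ (hmem q hq)]
    rfl
  have hpushV : ∀ q ∈ φ.range, (φ.push V).1 q = (Complex.exp (-m (φ.toHomeo.symm q)), 0) := by
    intro q hq
    obtain ⟨h1, -, h3, -, -⟩ := hframe _ (hmem q hq)
    rw [hpush V q hq, h1, h3]
  refine ⟨φ, hφB.trans hBN, hconn, VF.ext_on fun q hq => ?_, ⟨fun q hq => ?_,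
    VF.ext_on fun q hq => ?_⟩, fun q hq => ?_⟩
  · obtain ⟨-, h2, -, h4, -⟩ := hframe _ (hmem q hq)
    rw [hpush X q hq, h2, h4, dy_apply hq]
  · rw [hpushV q hq]
  · have hq' := hmem q hq
    have hs : HasFDerivAt φ.toHomeo.symm ((E (φ.toHomeo.symm q)).symm : ℂ × ℂ →L[ℂ] ℂ × ℂ) q :=
      φ.toHomeo.hasFDerivAt_symm hq (by rw [hφ]; exact hEd _ hq')
    have hm : HasFDerivAt (fun q => (Complex.exp (-m (φ.toHomeo.symm q)), (0 : ℂ))) _ q :=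
      (((hd _ hq').2.2.comp q hs).neg.cexp).prodMk (hasFDerivAt_const (0 : ℂ) q)
    rw [dx_lie_apply _ hq, VF.fderiv_eq hpushV hq, hm.fderiv]
    have h5 : m' (φ.toHomeo.symm q) (V.1 (φ.toHomeo.symm q)) = 0 := (hframe _ hq').2.2.2.2
    simp [hE' _ hq', h5]
  · rw [hpushV q hq]
    exact Complex.exp_ne_zero _

/-! ### From generic orbits to normal forms -/

lemma mem_span_of_orbitDim_eq_one {g : LieSubalgebra ℂ (VF U)} {p : ℂ × ℂ} (h : orbitDim g p = 1)
    {V W : VF U} (hV : V ∈ g) (hV0 : V.1 p ≠ 0) (hW : W ∈ g) : ∃ c : ℂ, W.1 p = c • V.1 p := by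
  have hVm : V.1 p ∈ g.toSubmodule.map (evalAt p) := ⟨V, hV, rfl⟩
  have hWm : W.1 p ∈ g.toSubmodule.map (evalAt p) := ⟨W, hW, rfl⟩
  obtain ⟨c, hc⟩ := (finrank_eq_one_iff_of_nonzero' (⟨V.1 p, hVm⟩ : g.toSubmodule.map (evalAt p))
    (fun h0 => hV0 (congrArg Subtype.val h0))).1 h ⟨W.1 p, hWm⟩
  exact ⟨c, (congrArg Subtype.val hc).symm⟩

lemma exists_ne_zero_of_orbitDim_eq_one {g : LieSubalgebra ℂ (VF U)} {p : ℂ × ℂ}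
    (h : orbitDim g p = 1) : ∃ V ∈ g, V.1 p ≠ 0 := by
  by_contra! h0
  have : g.toSubmodule.map (evalAt p) = ⊥ := by
    rw [eq_bot_iff]
    rintro _ ⟨V, hV, rfl⟩
    exact h0 V hV
  rw [orbitDim, this, finrank_bot] at h
  exact zero_ne_one h

lemma exists_planeDet_ne_zero_of_orbitDim_eq_two {g : LieSubalgebra ℂ (VF U)} {p : ℂ × ℂ}
    (h : orbitDim g p = 2) {v : ℂ × ℂ} (hv : v ≠ 0) : ∃ X ∈ g, planeDet v (X.1 p) ≠ 0 := by
  have htop : g.toSubmodule.map (evalAt p) = ⊤ := by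
    apply Submodule.eq_top_of_finrank_eq
    rw [← orbitDim, h, Module.finrank_prod, Module.finrank_self]
  by_cases h1 : v.1 = 0
  · have : ((1, 0) : ℂ × ℂ) ∈ g.toSubmodule.map (evalAt p) := htop ▸ Submodule.mem_top
    obtain ⟨X, hX, hXp⟩ := this
    have hXp' : X.1 p = (1, 0) := hXp
    refine ⟨X, hX, fun h0 => hv (Prod.ext h1 ?_)⟩
    simpa [planeDet, hXp'] using h0
  · have : ((0, 1) : ℂ × ℂ) ∈ g.toSubmodule.map (evalAt p) := htop ▸ Submodule.mem_top
    obtain ⟨X, hX, hXp⟩ := this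
    have hXp' : X.1 p = (0, 1) := hXp
    exact ⟨X, hX, by simpa [planeDet, hXp'] using h1⟩

lemma lie_eq_zero_of_isLieAbelian {L : Type*} [LieRing L] [LieAlgebra ℂ L]
    {k : LieSubalgebra ℂ L} (hk : IsLieAbelian k) {V W : L} (hV : V ∈ k) (hW : W ∈ k) :
    ⁅V, W⁆ = 0 :=
  congrArg Subtype.val (hk.trivial ⟨V, hV⟩ ⟨W, hW⟩)

/-- Local normal forms of the algebras of rank two whose commutator algebra is abelian of rank
one. -/
theorem exists_localCoordinates_isNormalForm {g : LieSubalgebra ℂ (VF U)}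
    (hfin : FiniteDimensional ℂ g) (h2 : HasRank g 2) (hab : IsLieAbelian (commutatorAlgebra g))
    (h1 : HasRank (commutatorAlgebra g) 1) {O : Opens (ℂ × ℂ)} (hO : O ≤ U)
    (hne : (O : Set (ℂ × ℂ)).Nonempty) :
    ∃ φ : LocalCoordinates U, φ.toHomeo.source ⊆ O ∧
      ∃ (S : Finset ℂ) (n : ℂ → ℕ), (∀ μ ∈ S, 0 < n μ) ∧
        IsNormalForm S n (g.toSubmodule.map φ.push) ∧
        (commutatorAlgebra g).toSubmodule.map φ.push = hSpace φ.range S n := by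
  obtain ⟨O₁, -, hd₁, hr₁⟩ := h1
  obtain ⟨O₂, -, hd₂, hr₂⟩ := h2
  have hne₂ : ((O ⊓ O₂ : Opens (ℂ × ℂ)) : Set (ℂ × ℂ)).Nonempty := by
    obtain ⟨p, hp⟩ := hne
    exact mem_closure_iff.1 (hd₂ (hO hp)) O O.isOpen hp
  have hne₁ : ((O ⊓ O₂ ⊓ O₁ : Opens (ℂ × ℂ)) : Set (ℂ × ℂ)).Nonempty := by
    obtain ⟨p, hp⟩ := hne₂
    exact mem_closure_iff.1 (hd₁ (hO hp.1)) _ (O ⊓ O₂).isOpen hp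
  obtain ⟨p, hp⟩ := hne₁
  obtain ⟨V, hV, hVp⟩ := exists_ne_zero_of_orbitDim_eq_one (hr₁ p hp.2)
  obtain ⟨X, hX, hVX⟩ := exists_planeDet_ne_zero_of_orbitDim_eq_two (hr₂ p hp.1.2) hVp
  have hVg := commutatorAlgebra_le g hV
  have hXV := lie_mem_commutatorAlgebra hX hVg
  obtain ⟨φ, hφ, hconn, hφX, hφV, hφV0⟩ := exists_adapted_coordinates
    (N := O ⊓ O₂ ⊓ O₁) (fun q hq => hO hq.1.1) hp hVX
    (fun q hq hq0 => mem_span_of_orbitDim_eq_one (hr₁ q hq.2) hV hq0 hXV)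
    (lie_eq_zero_of_isLieAbelian hab hV hXV)
  have hφO : φ.toHomeo.source ⊆ O := fun q hq => (hφ hq).1.1
  set F := g.map φ.pushHom
  have hFs : F.toSubmodule = g.toSubmodule.map φ.push := rfl
  have hF' := commutatorAlgebra_map_pushHom φ g
  have hmem : ∀ W ∈ commutatorAlgebra F, ∃ W' ∈ commutatorAlgebra g, φ.push W' = W := by
    intro W hW
    rw [← LieSubalgebra.mem_toSubmodule, hF'] at hW
    exact hW
  have hfin' : FiniteDimensional ℂ (commutatorAlgebra F) := by
    have : FiniteDimensional ℂ g.toSubmodule := hfin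
    have h3 : FiniteDimensional ℂ (commutatorAlgebra g).toSubmodule :=
      Submodule.finiteDimensional_of_le (S₂ := g.toSubmodule) (commutatorAlgebra_le g)
    have h4 : FiniteDimensional ℂ ((commutatorAlgebra g).toSubmodule.map φ.push) := inferInstance
    rw [← hF'] at h4
    exact h4
  obtain ⟨S, n, hn, hS, hcases⟩ := exists_classification hconn φ.range_nonempty
    (F := F) (V := φ.push V) ⟨X, hX, hφX⟩
    (fun A hA B hB => by
      obtain ⟨A', hA', rfl⟩ := hmem A hA
      obtain ⟨B', hB', rfl⟩ := hmem B hB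
      rw [← φ.push_lie, lie_eq_zero_of_isLieAbelian hab hA' hB', map_zero])
    (fun A hA q hq => by
      obtain ⟨A', hA', rfl⟩ := hmem A hA
      have hq' : φ.toHomeo.symm q ∈ φ.toHomeo.source := φ.toHomeo.symm.mapsTo hq
      have hV0 : V.1 (φ.toHomeo.symm q) ≠ 0 := fun h0 => hφV0 q hq (by
        rw [φ.push_apply V hq, h0, map_zero]; rfl)
      obtain ⟨c, hc⟩ := mem_span_of_orbitDim_eq_one (hr₁ _ (hφ hq').2) hV hV0 hA'
      rw [φ.push_apply A' hq, hc, map_smul, ← φ.push_apply V hq, Prod.smul_snd, hφV.1 q hq,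
        smul_zero])
    (by rw [← LieSubalgebra.mem_toSubmodule, hF']; exact ⟨V, hV, rfl⟩) hφV hφV0
  rw [hF'] at hS
  rw [hFs] at hcases
  rcases hcases with ⟨h0, h⟩ | h | ⟨c, h⟩
  · refine ⟨φ, hφO, S, n, hn, (isNormalForm_iff φ.range_nonempty).2 (Or.inl ?_), hS⟩
    rw [shear_zero]
    exact ⟨h0, h⟩
  · refine ⟨φ, hφO, S, n, hn,
      (isNormalForm_iff φ.range_nonempty).2 (Or.inr (Or.inr (Or.inl ?_))), hS⟩
    rw [shear_zero]
    exact h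
  -- The twist alters only the target coordinates, so the chart domain stays inside O.
  · obtain ⟨ψ, hψ, hrest⟩ := exists_isNormalForm_of_eq φ hn hS h
    exact ⟨ψ, hψ ▸ hφO, hrest⟩

end PlaneFields
end

open PlaneFields TopologicalSpace in
theorem corollary6p4 :
    -- every algebra of the kind considered is, in suitable local coordinates, one of the six forms
    (∀ (U : Opens (ℂ × ℂ)) (_ : IsConnected (U : Set (ℂ × ℂ)))
      (g : LieSubalgebra ℂ (VF U)) (_ : FiniteDimensional ℂ g)
      (_ : LieAlgebra.IsSolvable g) (_ : ¬ LieRing.IsNilpotent g) (_ : HasRank g 2)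
      (_ : IsLieAbelian (commutatorAlgebra g)) (_ : HasRank (commutatorAlgebra g) 1),
      ∀ O : Opens (ℂ × ℂ), O ≤ U → (O : Set (ℂ × ℂ)).Nonempty →
        ∃ φ : LocalCoordinates U, φ.toHomeo.source ⊆ O ∧
          ∃ (S : Finset ℂ) (n : ℂ → ℕ), (∀ μ ∈ S, 0 < n μ) ∧
            IsNormalForm S n (g.toSubmodule.map φ.push) ∧
            (commutatorAlgebra g).toSubmodule.map φ.push = hSpace φ.range S n) ∧
    -- each of the six forms is a Lie algebra with commutator algebra `h`
    (∀ (W : Opens (ℂ × ℂ)) (S : Finset ℂ) (n : ℂ → ℕ) (_ : ∀ μ ∈ S, 0 < n μ)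
      (F : Submodule ℂ (VF W)), IsNormalForm S n F →
        ∃ k : LieSubalgebra ℂ (VF W), k.toSubmodule = F ∧
          (commutatorAlgebra k).toSubmodule = hSpace W S n) := by
  exact ⟨fun U _ g hfin _ _ h2 hab h1 O hO hne =>
    exists_localCoordinates_isNormalForm hfin h2 hab h1 hO hne,
    fun W S n _ F hF => hF.exists_lieSubalgebra⟩
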